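/- Let $k$ be a field and let $\Lambda=\bigoplus_{t\ge 0}\Lambda_t$ be a locally finite graded $k$-algebra: $\Lambda_0=\bigoplus_{i\in Q_0}k e_i$ with orthogonal idempotents $e_i$ ($Q_0$ possibly infinite), every $x\in\Lambda$ satisfies $x=exe$ for a finite sum $e$ of the $e_i$, $\Lambda$ is generated by $\Lambda_0$ and $\Lambda_1$, and all $\Lambda_1e_i$ and $e_i\Lambda_1$ are finite-dimensional. Its bound quiver $Q$ has vertex set $Q_0$ and, as arrows from $i$ to $j$, the elements of a chosen basis of $e_j\Lambda_1e_i$, so that $\Lambda\simeq kQ/(\rho)$. An element of $kQ$ (in particular a path) is called bound if its image in $\Lambda$ is nonzero. A maximal bound path is a bound path that is not a proper subpath of a bound path. For $n\ge 0$, the quiver $Q$ is an $n$-translation quiver if there are subsets $\mathcal P,\mathcal I\subseteq Q_0$ and a bijection $\tau:Q_0\setminus\mathcal P\to Q_0\setminus\mathcal I$ such that: (1) for each $i\in Q_0\setminus\mathcal P$ there is a bound path of length $n+1$ from $\tau i$ to $i$, and every maximal bound path has length $n+1$ and runs from $\tau i$ to $i$ for some $i\in Q_0\setminus\mathcal P$;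 (2) for $i\in Q_0\setminus\mathcal P$, any two bound paths of length $n+1$ from $\tau i$ to $i$ are linearly dependent in $\Lambda$; (3) for $i\in Q_0\setminus\mathcal P$, $j\in Q_0$, $t\le n+1$ and every bound linear combination $u$ of paths of length $t$ from $j$ to $i$, there is a path $q$ of length $n+1-t$ from $\tau i$ to $j$ with $uq$ bound; (4) for $i\in Q_0\setminus\mathcal I$, $j\in Q_0$, $t\le n+1$ and every bound linear combination $u$ of paths of length $t$ from $i$ to $j$, there is a path $p$ of length $n+1-t$ from $j$ to $\tau^{-1}i$ with $pu$ bound. For $p,q\in\mathbb N\cup\{\infty\}$, $\Lambda$ is $(p,q)$-Koszul if $\Lambda_t=0$ for $t>p$ and, for each $i\in Q_0$, there is a complex $0\to P^q\to\cdots\to P^1\to P^0\to 0$ of graded projective left $\Lambda$-modules and degree-$0$ maps, with $P^t$ generated by its component of degree $t$, whose homology at $P^0$ in degree $0$ is the simple module $S(i)=\Lambda_0e_i$ and whose only other possibly nonzero homology occurs at $P^q$ in degree $p+q$ and is then equal to $\Lambda_p\otimes_{\Lambda_0}P^q_q$ (with $\Lambda_\infty=0$; for $q=\infty$ the complex is an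 infinite resolution). $\Lambda$ is Koszul if every $S(i)$ has a graded projective resolution $P^\bullet$ with $P^t$ generated in degree $t$. $\Lambda$ is self-injective if all the left modules $\Lambda e_i$ and all the right modules $e_i\Lambda$ are injective. $\Lambda$ is an $n$-translation algebra if its bound quiver (for some choice of arrows) is an $n$-translation quiver and $\Lambda$ is $(n+1,l)$-Koszul for some $l\in\mathbb N\cup\{\infty\}$. Let $D_*\Lambda=\bigoplus_{t,i,j}\operatorname{Hom}_k(e_j\Lambda_te_i,k)$ be the local dual bimodule, $(af)(z)=f(za)$, $(fa)(z)=f(az)$. The trivial extension $\Lambda\ltimes D_*\Lambda$ is $\Lambda\oplus D_*\Lambda$ with multiplication $(a,x)(b,y)=(ab,ay+xb)$. **Theorem.** Let $\Lambda$ be Koszul and self-injective. If $\Lambda$ is an $n$-translation algebra, then $\Lambda\ltimes D_*\Lambda$, with the idempotents $(e_i,0)$ and graded by $(\Lambda\ltimes D_*\Lambda)_t=\Lambda_t\oplus D_*(\Lambda_{n+2-t})$ (so that the forms on $\Lambda_{n+1}$ have degree $1$, and $\Lambda_s=0$ for $s<0$), is a locally finite graded algebra and an $(n+1)$-translation algebra.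 -/

import Mathlib

universe u

set_option linter.unusedSectionVars false

namespace NTrans

section Algebra

variable {k A V : Type u} [Field k] [NonUnitalRing A] [Module k A]

/-- A locally finite graded algebra `Λ = Λ₀ ⊕ Λ₁ ⊕ ⋯` over the field `k`, possibly without unit:
`𝒜 t` is the component `Λ_t`, and `e i`, `i ∈ V = Q₀`, are the orthogonal idempotents which form a
`k`-basis of `Λ₀` (so `Λ₀ = ⨁_{i ∈ Q₀} k e_i`). The algebra has local units, it is generated by
`Λ₀` and `Λ₁`, and only finitely many arrows start or end at each vertex. -/
class IsLocFinGraded (𝒜 : ℕ → Submodule k A) (e : V → A) : Prop where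
  isInternal : DirectSum.IsInternal 𝒜
  mul_mem : ∀ {s t : ℕ} {a b : A}, a ∈ 𝒜 s → b ∈ 𝒜 t → a * b ∈ 𝒜 (s + t)
  idem : ∀ i, e i * e i = e i
  orth : ∀ i j, i ≠ j → e i * e j = 0
  linearIndependent : LinearIndependent k e
  span_zero : Submodule.span k (Set.range e) = 𝒜 0
  local_unit : ∀ x : A, ∃ F : Finset V, (∑ i ∈ F, e i) * x = x ∧ x * (∑ i ∈ F, e i) = x
  generated : ∀ t : ℕ, 𝒜 (t + 1) = Submodule.span k {x | ∃ a ∈ 𝒜 1, ∃ b ∈ 𝒜 t, x = a * b}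
  finite_out : ∀ i, (Submodule.span k {x | ∃ a ∈ 𝒜 1, x = a * e i}).FG
  finite_in : ∀ i, (Submodule.span k {x | ∃ a ∈ 𝒜 1, x = e i * a}).FG

end Algebra

section BoundQuiver

variable {k A V : Type u} [Field k] [NonUnitalRing A] [Module k A]
  [IsScalarTower k A A] [SMulCommClass k A A]

/-- The space `e_j Λ_t e_i`. -/
def piece (𝒜 : ℕ → Submodule k A) (e : V → A) (t : ℕ) (i j : V) : Submodule k A where
  carrier := {x | x ∈ 𝒜 t ∧ e j * x = x ∧ x * e i = x}
  add_mem' := by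
    rintro a b ⟨ha, ha1, ha2⟩ ⟨hb, hb1, hb2⟩
    exact ⟨add_mem ha hb, by rw [mul_add, ha1, hb1], by rw [add_mul, ha2, hb2]⟩
  zero_mem' := ⟨zero_mem _, mul_zero _, zero_mul _⟩
  smul_mem' := by
    rintro c a ⟨ha, ha1, ha2⟩
    exact ⟨Submodule.smul_mem _ c ha, by rw [mul_smul_comm, ha1], by rw [smul_mul_assoc, ha2]⟩

/-- The product `x(α_r) ⋯ x(α₁) e_i` attached to a path `α_r ⋯ α₁` starting at `i`, where
`x(α) ∈ A` is a value chosen for each arrow `α`. -/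
def pathValue {A V : Type u} [NonUnitalRing A] [Quiver.{u} V] (e : V → A)
    (x : ∀ {i j : V}, (i ⟶ j) → A) {i : V} : {j : V} → Quiver.Path i j → A
  | _, .nil => e i
  | _, .cons p α => x α * pathValue e x p

/-- A quiver `Q` of the graded algebra `Λ`: the vertices are the elements of `V`, and the arrows
from `i` to `j` are the elements of a chosen basis of `e_j Λ₁ e_i`. -/
structure ArrowSystem (𝒜 : ℕ → Submodule k A) (e : V → A) where
  arr : V → V → Set A
  linearIndepOn : ∀ i j, LinearIndepOn k id (arr i j)
  span_arr : ∀ i j, Submodule.span k (arr i j) = piece 𝒜 e 1 i j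

namespace ArrowSystem

variable {𝒜 : ℕ → Submodule k A} {e : V → A} (Q : ArrowSystem 𝒜 e)

/-- The underlying quiver. -/
abbrev quiver : Quiver V := ⟨fun i j => Q.arr i j⟩

/-- Paths of `Q` from `i` to `j`. -/
abbrev Path (i j : V) : Type u := @Quiver.Path V Q.quiver i j

/-- The length of a path. -/
abbrev len {i j : V} (p : Q.Path i j) : ℕ := @Quiver.Path.length V Q.quiver i j p

/-- `Q.concat p q` is the path which runs first through `p` and then through `q`
(the path `qp` when paths are written like compositions of maps). -/
abbrev concat {i j l : V} (p : Q.Path i j) (q : Q.Path j l) : Q.Path i l :=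
  @Quiver.Path.comp V Q.quiver i j l p q

/-- The image in `Λ` of a path `α_r ⋯ α₁` of `Q`, the trivial path at `i` going to `e_i`.
As `Λ = kQ / (ρ)`, where the relations `ρ` generate the kernel of `kQ → Λ`, this is the image of
the path in the algebra of the bound quiver. -/
def eval {i j : V} (p : Q.Path i j) : A :=
  @pathValue A V _ Q.quiver e (fun {_ _} α => α.1) i j p

/-- The image in `Λ` of an element `∑ c_p p` of the path algebra, all the paths `p`
running from `i` to `j`. -/
noncomputable def evalLin {i j : V} (x : Q.Path i j →₀ k) : A :=
  x.sum fun p c => c • Q.eval p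

/-- A bound path: one with nonzero image in `Λ`. -/
def IsBound {i j : V} (p : Q.Path i j) : Prop := Q.eval p ≠ 0

/-- A maximal bound path: a bound path which is not a proper subpath of a bound path. -/
def IsMaximalBound {i j : V} (p : Q.Path i j) : Prop :=
  Q.IsBound p ∧ ∀ (i' j' : V) (q'' : Q.Path i' i) (q' : Q.Path j j'),
    Q.IsBound (Q.concat (Q.concat q'' p) q') → Q.len q'' = 0 ∧ Q.len q' = 0

/-- The bound quiver `Q` is an `n`-translation quiver with set of projective vertices `P`, set of
injective vertices `I` and `n`-translation `τ : Q₀ ∖ P → Q₀ ∖ I`. -/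
structure IsNTranslationQuiver (n : ℕ) (P I : Set V) (τ : ↥Pᶜ ≃ ↥Iᶜ) : Prop where
  exists_bound : ∀ i : ↥Pᶜ, ∃ p : Q.Path (τ i : V) (i : V), Q.len p = n + 1 ∧ Q.IsBound p
  maximal : ∀ (j i : V) (p : Q.Path j i), Q.IsMaximalBound p →
    Q.len p = n + 1 ∧ ∃ hi : i ∈ Pᶜ, ((τ ⟨i, hi⟩ : ↥Iᶜ) : V) = j
  dependent : ∀ (i : ↥Pᶜ) (p q : Q.Path (τ i : V) (i : V)),
    Q.len p = n + 1 → Q.len q = n + 1 → Q.IsBound p → Q.IsBound q →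
      ¬ LinearIndependent k ![Q.eval p, Q.eval q]
  extend_right : ∀ (i : ↥Pᶜ) (j : V) (t : ℕ) (x : Q.Path j (i : V) →₀ k), t ≤ n + 1 →
    (∀ p ∈ x.support, Q.len p = t) → Q.evalLin x ≠ 0 →
      ∃ q : Q.Path (τ i : V) j, Q.len q + t = n + 1 ∧ Q.evalLin x * Q.eval q ≠ 0
  extend_left : ∀ (i : ↥Iᶜ) (j : V) (t : ℕ) (x : Q.Path (i : V) j →₀ k), t ≤ n + 1 →
    (∀ p ∈ x.support, Q.len p = t) → Q.evalLin x ≠ 0 →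
      ∃ p : Q.Path j (τ.symm i : V), Q.len p + t = n + 1 ∧ Q.eval p * Q.evalLin x ≠ 0

end ArrowSystem

end BoundQuiver

section Modules

/-- A left module over the (possibly non-unital) `k`-algebra `A`. -/
structure LMod (k A : Type u) [Field k] [NonUnitalRing A] [Module k A] where
  carrier : Type u
  [addCommGroup : AddCommGroup carrier]
  [module : Module k carrier]
  act : A →ₗ[k] carrier →ₗ[k] carrier
  act_mul : ∀ (a b : A) (m : carrier), act (a * b) m = act a (act b m)

attribute [instance] LMod.addCommGroup LMod.module

variable {k A V : Type u} [Field k] [NonUnitalRing A] [Module k A]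

/-- `A M = M`. For an algebra with local units these are the modules in the usual sense. -/
def LMod.IsUnital (M : LMod k A) : Prop :=
  Submodule.span k {m : M.carrier | ∃ (a : A) (x : M.carrier), m = M.act a x} = ⊤

/-- Homomorphisms of left modules. -/
structure LHom (M N : LMod k A) where
  toLin : M.carrier →ₗ[k] N.carrier
  map_act : ∀ (a : A) (m : M.carrier), toLin (M.act a m) = N.act a (toLin m)

/-- `M` is injective in the category of left modules. -/
def LMod.IsInjective (M : LMod k A) : Prop :=
  ∀ (X Y : LMod k A), X.IsUnital → Y.IsUnital → ∀ (f : LHom X Y) (g : LHom X M),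
    Function.Injective f.toLin → ∃ h : LHom Y M, ∀ x, h.toLin (f.toLin x) = g.toLin x

/-- The left module `A ε = {x | x ε = x}` of an idempotent `ε`. -/
def leftIdeal (k : Type u) {A : Type u} [Field k] [NonUnitalRing A] [Module k A]
    [IsScalarTower k A A] [SMulCommClass k A A] (ε : A) : LMod k A where
  carrier := ↥(LinearMap.ker (LinearMap.mulRight k ε - LinearMap.id))
  act := LinearMap.mk₂ k
    (fun a x => ⟨a * (x : A), by
      have hx := x.2
      simp only [LinearMap.mem_ker, LinearMap.sub_apply, LinearMap.mulRight_apply,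
        LinearMap.id_apply, sub_eq_zero] at hx ⊢
      rw [mul_assoc, hx]⟩)
    (fun a b x => Subtype.ext (add_mul a b (x : A)))
    (fun c a x => Subtype.ext (smul_mul_assoc c a (x : A)))
    (fun a x y => Subtype.ext (mul_add a (x : A) (y : A)))
    (fun c a x => Subtype.ext (mul_smul_comm c a (x : A)))
  act_mul := fun a b x => Subtype.ext (by
    simp only [LinearMap.mk₂_apply]
    exact mul_assoc a b (x : A))

/-- `Λ` is self-injective: all the projective left modules `Λ e_i` and all the projective
right modules `e_i Λ` (left modules over the opposite algebra) are injective. -/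
def IsSelfInjective [IsScalarTower k A A] [SMulCommClass k A A] (e : V → A) : Prop :=
  (∀ i, (leftIdeal k (e i)).IsInjective) ∧
    ∀ i, (leftIdeal k (MulOpposite.op (e i))).IsInjective

/-- Graded left `Λ`-modules `M = ⨁_{t ∈ ℤ} M_t`. -/
structure GrMod (𝒜 : ℕ → Submodule k A) extends LMod k A where
  unital : toLMod.IsUnital
  deg : ℤ → Submodule k carrier
  isInternal : DirectSum.IsInternal deg
  act_mem : ∀ (s : ℕ) (t : ℤ) (a : A) (m : carrier), a ∈ 𝒜 s → m ∈ deg t →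
    act a m ∈ deg (s + t)

variable {𝒜 : ℕ → Submodule k A}

/-- Homomorphisms of graded modules (of degree `0`). -/
structure GrHom (M N : GrMod 𝒜) extends LHom M.toLMod N.toLMod where
  map_deg : ∀ (t : ℤ) (m : M.carrier), m ∈ M.deg t → toLin m ∈ N.deg t

/-- Projective objects of the category of graded left modules. -/
def GrMod.IsProjective (P : GrMod 𝒜) : Prop :=
  ∀ (M N : GrMod 𝒜) (f : GrHom M N) (g : GrHom P N), Function.Surjective f.toLin →
    ∃ h : GrHom P M, ∀ x, f.toLin (h.toLin x) = g.toLin x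

/-- `M` is generated by its component of degree `t`. -/
def GrMod.IsGeneratedIn (M : GrMod 𝒜) (t : ℤ) : Prop :=
  Submodule.span k {m : M.carrier | ∃ (a : A), ∃ x ∈ M.deg t, m = M.act a x} = ⊤

/-- `M` is isomorphic to the simple module `S(i) = Λ₀ e_i`, concentrated in degree `0`. -/
def GrMod.IsVertexSimple (M : GrMod 𝒜) (e : V → A) (i : V) : Prop :=
  M.deg 0 = ⊤ ∧ ∃ x : M.carrier, x ≠ 0 ∧ M.act (e i) x = x ∧ Submodule.span k {x} = ⊤

/-- A sequence `⋯ → P² → P¹ → P⁰ → S` of graded modules and homomorphisms. -/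
structure AugSeq (𝒜 : ℕ → Submodule k A) where
  S : GrMod 𝒜
  P : ℕ → GrMod 𝒜
  d : ∀ t, GrHom (P (t + 1)) (P t)
  aug : GrHom (P 0) S

/-- The kernel of the map which starts at `P^t`. -/
def AugSeq.cycles (C : AugSeq 𝒜) : (t : ℕ) → Submodule k (C.P t).carrier
  | 0 => LinearMap.ker C.aug.toLin
  | t + 1 => LinearMap.ker (C.d t).toLin

/-- The image of the map which ends at `P^t`. -/
def AugSeq.boundaries (C : AugSeq 𝒜) (t : ℕ) : Submodule k (C.P t).carrier :=
  LinearMap.range (C.d t).toLin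

/-- `S(i)` is a `(p,q)`-Koszul simple module: there is a graded complex
`0 → P^q → ⋯ → P¹ → P⁰ → 0` of projective modules, `P^t` generated in degree `t`, whose homology
is `S(i)` at `P⁰` (this is expressed by the augmentation `P⁰ → S(i)`), and otherwise `0`, except
that the kernel at `P^q` may also be `Λ_p ⊗ P^q_q`, which is the component of degree `p + q`
of `P^q`; here `Λ_∞ = 0`. For `q = ∞` it is a linear projective resolution of `S(i)`. -/
def IsPQKoszulSimple (𝒜 : ℕ → Submodule k A) (e : V → A) (p q : ℕ∞) (i : V) : Prop :=
  ∃ C : AugSeq 𝒜, C.S.IsVertexSimple e i ∧ Function.Surjective C.aug.toLin ∧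
    (∀ t, (C.P t).IsProjective ∧ (C.P t).IsGeneratedIn t) ∧
    (∀ t : ℕ, q < t → Subsingleton (C.P t).carrier) ∧
    (∀ t : ℕ, (t : ℕ∞) < q → C.cycles t = C.boundaries t) ∧
    (∀ t : ℕ, (t : ℕ∞) = q → C.cycles t = ⊥ ∨
      ∃ p' : ℕ, p = p' ∧ C.cycles t = (C.P t).deg ((p' : ℤ) + t))

/-- `(p,q)`-Koszul (almost Koszul) algebras, `p, q ∈ ℕ ∪ {∞}`. -/
def IsPQKoszul (𝒜 : ℕ → Submodule k A) (e : V → A) (p q : ℕ∞) : Prop :=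
  (∀ t : ℕ, p < t → 𝒜 t = ⊥) ∧ ∀ i, IsPQKoszulSimple 𝒜 e p q i

/-- Koszul algebras: every simple module `S(i)` has a linear projective resolution
(for `p = q = ∞` the remaining conditions are void). -/
def IsKoszul (𝒜 : ℕ → Submodule k A) (e : V → A) : Prop :=
  IsPQKoszul 𝒜 e ⊤ ⊤

/-- `n`-translation algebras: locally finite graded algebras whose bound quiver is an
`n`-translation quiver and which are `(n+1,l)`-Koszul for some `l ∈ ℕ ∪ {∞}`. -/
def IsNTranslationAlgebra [IsScalarTower k A A] [SMulCommClass k A A]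
    (𝒜 : ℕ → Submodule k A) (e : V → A) (n : ℕ) : Prop :=
  IsLocFinGraded 𝒜 e ∧
    (∃ (Q : ArrowSystem 𝒜 e) (P I : Set V) (τ : ↥Pᶜ ≃ ↥Iᶜ), Q.IsNTranslationQuiver n P I τ) ∧
    ∃ l : ℕ∞, IsPQKoszul 𝒜 e ((n + 1 : ℕ) : ℕ∞) l

end Modules

section TrivialExtension

variable {k A V : Type u} [Field k] [NonUnitalRing A] [Module k A]
  [IsScalarTower k A A] [SMulCommClass k A A]

/-- The local dual `D_* Λ = ⨁_{t,i,j} Hom_k (e_j Λ_t e_i, k)`: the linear forms on `Λ` which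
vanish on all but finitely many of the spaces `e_j Λ_t e_i`. -/
def localDual (𝒜 : ℕ → Submodule k A) (e : V → A) : Submodule k (Module.Dual k A) where
  carrier := {f | ∃ (N : ℕ) (F : Finset V), (∀ t, N < t → ∀ x ∈ 𝒜 t, f x = 0) ∧
    ∀ j, j ∉ F → ∀ x, f (e j * x) = 0 ∧ f (x * e j) = 0}
  zero_mem' := ⟨0, ∅, fun _ _ _ _ => rfl, fun _ _ _ => ⟨rfl, rfl⟩⟩
  add_mem' := by
    classical
    rintro f g ⟨N, F, hN, hF⟩ ⟨N', F', hN', hF'⟩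
    refine ⟨max N N', F ∪ F', fun t ht x hx => ?_, fun j hj x => ?_⟩
    · rw [LinearMap.add_apply, hN t (lt_of_le_of_lt (le_max_left _ _) ht) x hx,
        hN' t (lt_of_le_of_lt (le_max_right _ _) ht) x hx, add_zero]
    · rw [Finset.mem_union, not_or] at hj
      simp [hF j hj.1 x, hF' j hj.2 x]
  smul_mem' := by
    rintro c f ⟨N, F, hN, hF⟩
    refine ⟨N, F, fun t ht x hx => ?_, fun j hj x => ?_⟩
    · simp [hN t ht x hx]
    · simp [hF j hj x]

variable (𝒜 : ℕ → Submodule k A) (e : V → A)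

theorem mul_unit_eq_zero [h : IsLocFinGraded 𝒜 e] (a : A) :
    ∃ G : Finset V, ∀ j, j ∉ G → e j * a = 0 ∧ a * e j = 0 := by
  obtain ⟨G, h1, h2⟩ := h.local_unit a
  refine ⟨G, fun j hj => ⟨?_, ?_⟩⟩
  · rw [← h1, ← mul_assoc, Finset.mul_sum, Finset.sum_eq_zero, zero_mul]
    intro i hi
    exact h.orth j i (by rintro rfl; exact hj hi)
  · rw [← h2, mul_assoc, Finset.sum_mul, Finset.sum_eq_zero, mul_zero]
    intro i hi
    exact h.orth i j (by rintro rfl; exact hj hi)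

theorem left_mem [h : IsLocFinGraded 𝒜 e] (a : A) {f : Module.Dual k A}
    (hf : f ∈ localDual 𝒜 e) : f ∘ₗ LinearMap.mulRight k a ∈ localDual 𝒜 e := by
  classical
  obtain ⟨N, F, hN, hF⟩ := hf
  obtain ⟨G, hG⟩ := mul_unit_eq_zero 𝒜 e a
  refine ⟨N, F ∪ G, fun t ht x hx => ?_, fun j hj x => ?_⟩
  · clear hG
    have ha : a ∈ ⨆ s, 𝒜 s := by rw [h.isInternal.submodule_iSup_eq_top]; trivial
    induction ha using Submodule.iSup_induction' with
    | mem s y hy => exact hN (t + s) (by omega) _ (h.mul_mem hx hy)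
    | zero => simp
    | add y z _ _ hy hz =>
      simp only [LinearMap.comp_apply, LinearMap.mulRight_apply, mul_add, map_add] at hy hz ⊢
      rw [hy, hz, add_zero]
  · rw [Finset.mem_union, not_or] at hj
    simp [mul_assoc, (hF j hj.1 (x * a)).1, (hG j hj.2).1]

theorem right_mem [h : IsLocFinGraded 𝒜 e] (a : A) {f : Module.Dual k A}
    (hf : f ∈ localDual 𝒜 e) : f ∘ₗ LinearMap.mulLeft k a ∈ localDual 𝒜 e := by
  classical
  obtain ⟨N, F, hN, hF⟩ := hf
  obtain ⟨G, hG⟩ := mul_unit_eq_zero 𝒜 e a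
  refine ⟨N, F ∪ G, fun t ht x hx => ?_, fun j hj x => ?_⟩
  · clear hG
    have ha : a ∈ ⨆ s, 𝒜 s := by rw [h.isInternal.submodule_iSup_eq_top]; trivial
    induction ha using Submodule.iSup_induction' with
    | mem s y hy => exact hN (s + t) (by omega) _ (h.mul_mem hy hx)
    | zero => simp
    | add y z _ _ hy hz =>
      simp only [LinearMap.comp_apply, LinearMap.mulLeft_apply, add_mul, map_add] at hy hz ⊢
      rw [hy, hz, add_zero]
  · rw [Finset.mem_union, not_or] at hj
    simp [← mul_assoc, (hF j hj.1 (a * x)).2, (hG j hj.2).2]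

/-- The trivial extension `Λ ⋉ D_* Λ`, the vector space `Λ ⊕ D_* Λ`. -/
def TrivExt (𝒜 : ℕ → Submodule k A) (e : V → A) : Type u := A × ↥(localDual 𝒜 e)

instance : AddCommGroup (TrivExt 𝒜 e) :=
  inferInstanceAs (AddCommGroup (A × ↥(localDual 𝒜 e)))

instance : Module k (TrivExt 𝒜 e) :=
  inferInstanceAs (Module k (A × ↥(localDual 𝒜 e)))

variable {𝒜 e}

theorem TrivExt.ext' {x y : TrivExt 𝒜 e} (h1 : x.1 = y.1)
    (h2 : ∀ z : A, x.2.1 z = y.2.1 z) : x = y :=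
  Prod.ext h1 (Subtype.ext (LinearMap.ext h2))

variable [IsLocFinGraded 𝒜 e]

/-- The left action `(a f)(z) = f (z a)` on `D_* Λ`. -/
def leftAct (a : A) (f : localDual 𝒜 e) : localDual 𝒜 e :=
  ⟨f.1 ∘ₗ LinearMap.mulRight k a, left_mem 𝒜 e a f.2⟩

/-- The right action `(f a)(z) = f (a z)` on `D_* Λ`. -/
def rightAct (f : localDual 𝒜 e) (a : A) : localDual 𝒜 e :=
  ⟨f.1 ∘ₗ LinearMap.mulLeft k a, right_mem 𝒜 e a f.2⟩

/-- `(a, x) (b, y) = (a b, a y + x b)`. -/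
instance : Mul (TrivExt 𝒜 e) :=
  ⟨fun x y => (x.1 * y.1, leftAct x.1 y.2 + rightAct x.2 y.1)⟩

theorem TrivExt.mul_fst (x y : TrivExt 𝒜 e) : (x * y).1 = x.1 * y.1 := rfl

theorem TrivExt.mul_snd (x y : TrivExt 𝒜 e) (z : A) :
    (x * y).2.1 z = y.2.1 (z * x.1) + x.2.1 (y.1 * z) := rfl

theorem TrivExt.add_fst (x y : TrivExt 𝒜 e) : (x + y).1 = x.1 + y.1 := rfl

theorem TrivExt.add_snd (x y : TrivExt 𝒜 e) (z : A) :
    (x + y).2.1 z = x.2.1 z + y.2.1 z := rfl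

theorem TrivExt.smul_fst (c : k) (x : TrivExt 𝒜 e) : (c • x).1 = c • x.1 := rfl

theorem TrivExt.smul_snd (c : k) (x : TrivExt 𝒜 e) (z : A) :
    (c • x).2.1 z = c • x.2.1 z := rfl

theorem TrivExt.zero_fst : (0 : TrivExt 𝒜 e).1 = 0 := rfl

theorem TrivExt.zero_snd (z : A) : (0 : TrivExt 𝒜 e).2.1 z = 0 := rfl

instance : NonUnitalRing (TrivExt 𝒜 e) where
  left_distrib x y z := by
    refine TrivExt.ext' ?_ fun w => ?_
    · simp only [TrivExt.mul_fst, TrivExt.add_fst, mul_add]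
    · simp only [TrivExt.mul_snd, TrivExt.add_snd, TrivExt.add_fst, add_mul, map_add]
      abel
  right_distrib x y z := by
    refine TrivExt.ext' ?_ fun w => ?_
    · simp only [TrivExt.mul_fst, TrivExt.add_fst, add_mul]
    · simp only [TrivExt.mul_snd, TrivExt.add_snd, TrivExt.add_fst, mul_add, map_add]
      abel
  zero_mul x := by
    refine TrivExt.ext' ?_ fun w => ?_
    · simp only [TrivExt.mul_fst, TrivExt.zero_fst, zero_mul]
    · simp only [TrivExt.mul_snd, TrivExt.zero_snd, TrivExt.zero_fst, mul_zero, map_zero, add_zero]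
  mul_zero x := by
    refine TrivExt.ext' ?_ fun w => ?_
    · simp only [TrivExt.mul_fst, TrivExt.zero_fst, mul_zero]
    · simp only [TrivExt.mul_snd, TrivExt.zero_snd, TrivExt.zero_fst, zero_mul, map_zero, add_zero]
  mul_assoc x y z := by
    refine TrivExt.ext' ?_ fun w => ?_
    · simp only [TrivExt.mul_fst, mul_assoc]
    · simp only [TrivExt.mul_snd, TrivExt.mul_fst, mul_assoc]
      abel

instance : IsScalarTower k (TrivExt 𝒜 e) (TrivExt 𝒜 e) where
  smul_assoc c x y := by
    refine TrivExt.ext' ?_ fun w => ?_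
    · simp only [smul_eq_mul, TrivExt.mul_fst, TrivExt.smul_fst, smul_mul_assoc]
    · simp only [smul_eq_mul, TrivExt.mul_snd, TrivExt.smul_snd, TrivExt.smul_fst,
        mul_smul_comm, map_smul, mul_add]

instance : SMulCommClass k (TrivExt 𝒜 e) (TrivExt 𝒜 e) where
  smul_comm c x y := by
    refine TrivExt.ext' ?_ fun w => ?_
    · simp only [smul_eq_mul, TrivExt.mul_fst, TrivExt.smul_fst, mul_smul_comm]
    · simp only [smul_eq_mul, TrivExt.mul_snd, TrivExt.smul_snd, TrivExt.smul_fst,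
        smul_mul_assoc, map_smul, mul_add]

end TrivialExtension

section TrivialExtensionGrading

/-- The grading of the trivial extension of an algebra with `Λ_s = 0` for `s > n + 1` in which the
forms on `Λ_{n+1}` have degree `1`: `(Λ ⋉ D_* Λ)_t = Λ_t ⊕ D_* (Λ_{n+2-t})`. -/
def TrivExt.grading {k A V : Type u} [Field k] [NonUnitalRing A] [Module k A]
    [IsScalarTower k A A] [SMulCommClass k A A] (𝒜 : ℕ → Submodule k A) (e : V → A)
    (n : ℕ) (t : ℕ) : Submodule k (TrivExt 𝒜 e) where
  carrier := {x | x.1 ∈ 𝒜 t ∧ ∀ s : ℕ, s + t ≠ n + 2 → ∀ z ∈ 𝒜 s, x.2.1 z = 0}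
  zero_mem' := ⟨zero_mem (𝒜 t), fun _ _ _ _ => rfl⟩
  add_mem' := by
    rintro x y ⟨hx, hx'⟩ ⟨hy, hy'⟩
    refine ⟨add_mem hx hy, fun s hs z hz => ?_⟩
    change x.2.1 z + y.2.1 z = 0
    rw [hx' s hs z hz, hy' s hs z hz, add_zero]
  smul_mem' := by
    rintro c x ⟨hx, hx'⟩
    refine ⟨Submodule.smul_mem _ c hx, fun s hs z hz => ?_⟩
    change c • x.2.1 z = 0
    rw [hx' s hs z hz, smul_zero]

/-- The idempotents `(e_i, 0)` of the trivial extension. -/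
def TrivExt.idem {k A V : Type u} [Field k] [NonUnitalRing A] [Module k A]
    [IsScalarTower k A A] [SMulCommClass k A A] (𝒜 : ℕ → Submodule k A) (e : V → A)
    (i : V) : TrivExt 𝒜 e := (e i, 0)

end TrivialExtensionGrading

end NTrans

/-!
The theorem holds because `D_* Λ` is, up to a twist, `Λ` itself, so that `Λ ⋉ D_* Λ` is a skew
version of `Λ[φ] / (φ²)` with `φ` of degree `1`, and this construction preserves the Koszul
property.

For an `n`-translation quiver of a self-injective algebra there are no projective and no injective
vertices: if `p` is a bound path from `i` which cannot be prolonged at its end and `p q` is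
maximal bound, then by injectivity of `Λ e_i` the map `p q ↦ p` of simple submodules extends to
a homomorphism `Λ e_l → Λ e_i`, where `q` starts at `l`, so `p = p q y`, and `q` is
trivial by degree reasons (`ArrowSystem.IsNTranslationQuiver.notMem_injective`). Hence `τ` is a permutation of the vertices,
every nonzero element of `e_i Λ_t e_j` extends to a nonzero element of the one-dimensional space
`e_i Λ_{n+1} e_{τ i}`, and a linear form `φ` which is nonzero exactly on these spaces is
nondegenerate (`IsTopNondegenerate.exists_isFrobeniusForm`). With `φ(ν(a) z) = φ(z a)` one obtains
`D_* Λ = φ Λ` and `a φ = φ ν(a)` for an automorphism `ν` of the graded algebra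
(`IsFrobeniusForm.nonempty_nakayamaIso`).

In the trivial extension the pairing of `Λ` with `D_* Λ` is symmetric and nondegenerate with
values in degree `n + 2`, so every bound path from `i` to `j` is part of a bound cycle of length
`n + 2`, and the identity is an `(n+1)`-translation (`ArrowSystem.isNTranslationQuiver_refl`,
`TrivExt.exists_mul_ne_zero`).

A `Λ`-module `M` induces the module `Ind M = M ⊕ φ M` over the trivial extension. Induction is
exact and preserves projectivity (`NakayamaIso.isProjective_induce`), and the multiplication by
`φ` gives an exact sequence `⋯ → Ind (M^{ν²})(-2) → Ind (M^ν)(-1) → Ind M → M → 0`, functorial in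
`M`, with `M^ν` the twist of `M` by `ν`. Applied to a linear resolution `P^•` of `S(i)` over `Λ`
it yields a double complex, whose total complex is a linear resolution of `S(i)` over the trivial
extension (`AugSeq.cycles_trivExt`), with the term `⨁_{a ≤ t} Ind ((P^a)^{ν^{t-a}})(a-t)` in
degree `t`. So the trivial extension is `(n+2, ∞)`-Koszul.
-/

namespace NTrans

/-! ### Homogeneous components -/

section GradedAlgebra

variable {k A V : Type u} [Field k] [NonUnitalRing A] [Module k A]
  [IsScalarTower k A A] [SMulCommClass k A A]
  {𝒜 : ℕ → Submodule k A} {e : V → A} [h : IsLocFinGraded 𝒜 e]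

theorem idem_mem (i : V) : e i ∈ 𝒜 0 := by
  rw [← h.span_zero]
  exact Submodule.subset_span ⟨i, rfl⟩

theorem idem_ne_zero (𝒜 : ℕ → Submodule k A) {e : V → A} [h : IsLocFinGraded 𝒜 e] (i : V) :
    e i ≠ 0 :=
  h.linearIndependent.ne_zero i

theorem iSup_grading (𝒜 : ℕ → Submodule k A) (e : V → A) [h : IsLocFinGraded 𝒜 e] :
    ⨆ t, 𝒜 t = ⊤ :=
  h.isInternal.submodule_iSup_eq_top

theorem iSupIndep_grading (𝒜 : ℕ → Submodule k A) (e : V → A) [h : IsLocFinGraded 𝒜 e] :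
    iSupIndep 𝒜 :=
  h.isInternal.submodule_iSupIndep

theorem homogeneous_induction (𝒜 : ℕ → Submodule k A) (e : V → A) [h : IsLocFinGraded 𝒜 e]
    {p : A → Prop} (mem : ∀ t, ∀ x ∈ 𝒜 t, p x) (zero : p 0) (add : ∀ x y, p x → p y → p (x + y))
    (x : A) : p x := by
  have hx : x ∈ ⨆ t, 𝒜 t := by rw [iSup_grading 𝒜 e]; trivial
  exact Submodule.iSup_induction 𝒜 (motive := p) hx mem zero add

/-- The projection of `Λ` onto its component of degree `t`. -/
noncomputable def homProj (𝒜 : ℕ → Submodule k A) (e : V → A) [h : IsLocFinGraded 𝒜 e] (t : ℕ) :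
    A →ₗ[k] A :=
  letI := h.isInternal.chooseDecomposition
  (𝒜 t).subtype ∘ₗ DirectSum.component k ℕ (fun t => 𝒜 t) t ∘ₗ
    (DirectSum.decomposeLinearEquiv 𝒜).toLinearMap

theorem homProj_mem (t : ℕ) (x : A) : homProj 𝒜 e t x ∈ 𝒜 t :=
  Subtype.property _

theorem homProj_of_mem {t : ℕ} {x : A} (hx : x ∈ 𝒜 t) : homProj 𝒜 e t x = x :=
  letI := h.isInternal.chooseDecomposition
  DirectSum.decompose_of_mem_same 𝒜 hx

theorem homProj_of_mem_of_ne {s t : ℕ} (hst : s ≠ t) {x : A} (hx : x ∈ 𝒜 s) :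
    homProj 𝒜 e t x = 0 :=
  letI := h.isInternal.chooseDecomposition
  DirectSum.decompose_of_mem_ne 𝒜 hx hst

theorem eq_zero_of_homProj_eq_zero {x : A} (hx : ∀ t, homProj 𝒜 e t x = 0) : x = 0 := by
  let := h.isInternal.chooseDecomposition
  have : DirectSum.decompose 𝒜 x = 0 := DFinsupp.ext fun t => Subtype.ext (hx t)
  exact (DirectSum.decompose 𝒜).injective (this.trans (DirectSum.decompose_zero 𝒜).symm)

theorem mem_of_homProj_eq_zero {x : A} {t : ℕ} (hx : ∀ s, s ≠ t → homProj 𝒜 e s x = 0) :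
    x ∈ 𝒜 t := by
  have : x - homProj 𝒜 e t x = 0 := by
    refine eq_zero_of_homProj_eq_zero (𝒜 := 𝒜) (e := e) fun s => ?_
    by_cases hs : s = t
    · subst hs
      rw [map_sub, homProj_of_mem (homProj_mem s x), sub_self]
    · rw [map_sub, hx s hs, homProj_of_mem_of_ne (Ne.symm hs) (homProj_mem t x), sub_self]
  rw [sub_eq_zero.1 this]
  exact homProj_mem t x

theorem homProj_mul_right {s : ℕ} {z : A} (hz : z ∈ 𝒜 s) (t : ℕ) (a : A) :
    homProj 𝒜 e (t + s) (a * z) = homProj 𝒜 e t a * z := by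
  induction a using homogeneous_induction 𝒜 e with
  | mem u x hx =>
    by_cases hu : u = t
    · subst hu
      rw [homProj_of_mem hx, homProj_of_mem (h.mul_mem hx hz)]
    · rw [homProj_of_mem_of_ne hu hx, homProj_of_mem_of_ne (by omega) (h.mul_mem hx hz), zero_mul]
  | zero => simp
  | add x y hx hy => simp [add_mul, hx, hy]

theorem homProj_mul_left {s : ℕ} {z : A} (hz : z ∈ 𝒜 s) (t : ℕ) (a : A) :
    homProj 𝒜 e (s + t) (z * a) = z * homProj 𝒜 e t a := by
  induction a using homogeneous_induction 𝒜 e with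
  | mem u x hx =>
    by_cases hu : u = t
    · subst hu
      rw [homProj_of_mem hx, homProj_of_mem (h.mul_mem hz hx)]
    · rw [homProj_of_mem_of_ne hu hx, homProj_of_mem_of_ne (by omega) (h.mul_mem hz hx), mul_zero]
  | zero => simp
  | add x y hx hy => simp [mul_add, hx, hy]

/-! ### Sums of idempotents -/

theorem sum_idem_mem (F : Finset V) : ∑ i ∈ F, e i ∈ 𝒜 0 :=
  Submodule.sum_mem _ fun i _ => idem_mem i

theorem sum_idem_mul_idem (𝒜 : ℕ → Submodule k A) {e : V → A} [h : IsLocFinGraded 𝒜 e]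
    {F : Finset V} {i : V} (hi : i ∈ F) : (∑ j ∈ F, e j) * e i = e i := by
  rw [Finset.sum_mul, Finset.sum_eq_single_of_mem i hi, h.idem]
  exact fun j _ hj => h.orth j i hj

theorem idem_mul_sum_idem (𝒜 : ℕ → Submodule k A) {e : V → A} [h : IsLocFinGraded 𝒜 e]
    {F : Finset V} {i : V} (hi : i ∈ F) : e i * (∑ j ∈ F, e j) = e i := by
  rw [Finset.mul_sum, Finset.sum_eq_single_of_mem i hi, h.idem]
  exact fun j _ hj => h.orth i j (Ne.symm hj)

theorem sum_idem_mul_sum_idem (𝒜 : ℕ → Submodule k A) {e : V → A} [h : IsLocFinGraded 𝒜 e]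
    {F G : Finset V} (hFG : F ⊆ G) : (∑ j ∈ G, e j) * (∑ j ∈ F, e j) = ∑ j ∈ F, e j := by
  rw [Finset.mul_sum]
  exact Finset.sum_congr rfl fun i hi => sum_idem_mul_idem 𝒜 (hFG hi)

theorem sum_idem_mul_sum_idem' (𝒜 : ℕ → Submodule k A) {e : V → A} [h : IsLocFinGraded 𝒜 e]
    {F G : Finset V} (hFG : F ⊆ G) : (∑ j ∈ F, e j) * (∑ j ∈ G, e j) = ∑ j ∈ F, e j := by
  rw [Finset.sum_mul]
  exact Finset.sum_congr rfl fun i hi => idem_mul_sum_idem 𝒜 (hFG hi)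

theorem sum_idem_mul_of_subset (𝒜 : ℕ → Submodule k A) {e : V → A} [h : IsLocFinGraded 𝒜 e]
    {F G : Finset V} (hFG : F ⊆ G) {x : A}
    (hx : (∑ j ∈ F, e j) * x = x) : (∑ j ∈ G, e j) * x = x := by
  rw [← hx, ← mul_assoc, sum_idem_mul_sum_idem 𝒜 hFG]

theorem mul_sum_idem_of_subset (𝒜 : ℕ → Submodule k A) {e : V → A} [h : IsLocFinGraded 𝒜 e]
    {F G : Finset V} (hFG : F ⊆ G) {x : A}
    (hx : x * (∑ j ∈ F, e j) = x) : x * (∑ j ∈ G, e j) = x := by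
  rw [← hx, mul_assoc, sum_idem_mul_sum_idem' 𝒜 hFG]

/-! ### The spaces `e_j Λ_t e_i` -/

theorem sandwich_mem_piece {t : ℕ} {x : A} (hx : x ∈ 𝒜 t) (i j : V) :
    e j * x * e i ∈ piece 𝒜 e t i j := by
  refine ⟨?_, ?_, ?_⟩
  · have := h.mul_mem (h.mul_mem (idem_mem (e := e) j) hx) (idem_mem (e := e) i)
    simpa using this
  · rw [← mul_assoc, ← mul_assoc, h.idem]
  · rw [mul_assoc, h.idem]

theorem idem_mem_piece (i : V) : e i ∈ piece 𝒜 e 0 i i :=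
  ⟨idem_mem i, h.idem i, h.idem i⟩

theorem mul_mem_piece {s t : ℕ} {i j l : V} {a b : A} (ha : a ∈ piece 𝒜 e s j l)
    (hb : b ∈ piece 𝒜 e t i j) : a * b ∈ piece 𝒜 e (s + t) i l :=
  ⟨h.mul_mem ha.1 hb.1, by rw [← mul_assoc, ha.2.1], by rw [mul_assoc, hb.2.2]⟩

theorem eq_sum_sandwich (𝒜 : ℕ → Submodule k A) (e : V → A) [h : IsLocFinGraded 𝒜 e] (x : A) :
    ∃ F : Finset V, x = ∑ j ∈ F, ∑ i ∈ F, e j * x * e i := by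
  obtain ⟨F, h1, h2⟩ := h.local_unit x
  refine ⟨F, ?_⟩
  simp_rw [← Finset.mul_sum, mul_assoc, ← Finset.sum_mul, h2, h1]

/-- An additive property of elements of `Λ` may be checked on the spaces `e_j Λ_t e_i`. -/
theorem piece_induction (𝒜 : ℕ → Submodule k A) (e : V → A) [h : IsLocFinGraded 𝒜 e]
    {p : A → Prop} (mem : ∀ t i j, ∀ x ∈ piece 𝒜 e t i j, p x) (zero : p 0)
    (add : ∀ x y, p x → p y → p (x + y)) (x : A) : p x := by
  have hsum : ∀ {ι : Type u} (F : Finset ι) (f : ι → A), (∀ i ∈ F, p (f i)) → p (∑ i ∈ F, f i) :=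
    fun F f hf => Finset.sum_induction f p add zero hf
  induction x using homogeneous_induction 𝒜 e with
  | mem t x hx =>
    obtain ⟨F, hF⟩ := eq_sum_sandwich 𝒜 e x
    rw [hF]
    exact hsum _ _ fun j _ => hsum _ _ fun i _ => mem t i j _ (sandwich_mem_piece hx i j)
  | zero => exact zero
  | add x y hx hy => exact add _ _ hx hy

theorem exists_sandwich_ne_zero (𝒜 : ℕ → Submodule k A) (e : V → A) [h : IsLocFinGraded 𝒜 e]
    {x : A} (hx : x ≠ 0) : ∃ i j, e j * x * e i ≠ 0 := by
  by_contra! hc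
  obtain ⟨F, hF⟩ := eq_sum_sandwich 𝒜 e x
  exact hx (by rw [hF]; exact Finset.sum_eq_zero fun j _ => Finset.sum_eq_zero fun i _ => hc i j)

theorem mul_idem_mem_span {x : A} (hx : x ∈ 𝒜 0) (i : V) :
    x * e i ∈ Submodule.span k {e i} ∧ e i * x ∈ Submodule.span k {e i} := by
  rw [← h.span_zero] at hx
  induction hx using Submodule.span_induction with
  | mem x hx =>
    obtain ⟨j, rfl⟩ := hx
    by_cases hij : i = j
    · subst hij
      rw [h.idem]
      exact ⟨Submodule.mem_span_singleton_self _, Submodule.mem_span_singleton_self _⟩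
    · rw [h.orth i j hij, h.orth j i (Ne.symm hij)]
      exact ⟨zero_mem _, zero_mem _⟩
  | zero => simp
  | add x y _ _ hx hy =>
    rw [add_mul, mul_add]
    exact ⟨add_mem hx.1 hy.1, add_mem hx.2 hy.2⟩
  | smul c x _ hx =>
    rw [smul_mul_assoc, mul_smul_comm]
    exact ⟨Submodule.smul_mem _ _ hx.1, Submodule.smul_mem _ _ hx.2⟩

/-- `e_j Λ₀ e_i` is `k e_i` for `i = j` and zero otherwise. -/
theorem exists_smul_of_mem_zero {x : A} (hx : x ∈ 𝒜 0) (i j : V) :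
    ∃ c : k, e j * x * e i = c • e i ∧ (j ≠ i → c = 0) := by
  rw [← h.span_zero] at hx
  induction hx using Submodule.span_induction with
  | mem x hx =>
    obtain ⟨l, rfl⟩ := hx
    by_cases hl : l = i
    · subst hl
      by_cases hj : j = l
      · subst hj
        exact ⟨1, by rw [h.idem, h.idem, one_smul], fun hc => (hc rfl).elim⟩
      · exact ⟨0, by rw [h.orth j l hj, zero_mul, zero_smul], fun _ => rfl⟩
    · exact ⟨0, by rw [mul_assoc, h.orth l i hl, mul_zero, zero_smul], fun _ => rfl⟩
  | zero => exact ⟨0, by simp, fun _ => rfl⟩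
  | add x y _ _ hx hy =>
    obtain ⟨c, hc, hc'⟩ := hx
    obtain ⟨d, hd, hd'⟩ := hy
    exact ⟨c + d, by rw [mul_add, add_mul, hc, hd, add_smul],
      fun hj => by rw [hc' hj, hd' hj, add_zero]⟩
  | smul a x _ hx =>
    obtain ⟨c, hc, hc'⟩ := hx
    exact ⟨a * c, by rw [mul_smul_comm, smul_mul_assoc, hc, mul_smul],
      fun hj => by rw [hc' hj, mul_zero]⟩

theorem eq_of_mem_piece_zero {i j : V} {x : A} (hx : x ∈ piece 𝒜 e 0 i j) (hx0 : x ≠ 0) :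
    i = j := by
  by_contra hij
  obtain ⟨c, hc, hc'⟩ := exists_smul_of_mem_zero (e := e) hx.1 i j
  rw [hx.2.1, hx.2.2, hc' (Ne.symm hij), zero_smul] at hc
  exact hx0 hc

/-- Every `Λ_t e_i` has finite dimension: `Λ_{t+1} e_i = Λ₁ (Λ_t e_i)`, and a basis of `Λ_t e_i`
meets only finitely many of the spaces `Λ₁ e_j`. -/
theorem finite_mulRight (t : ℕ) (i : V) : ((𝒜 t).map (LinearMap.mulRight k (e i))).FG := by
  classical
  induction t with
  | zero =>
    refine Submodule.FG.of_le (Submodule.fg_span_singleton (R := k) (e i)) ?_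
    rintro _ ⟨x, hx, rfl⟩
    obtain ⟨F, hF, -⟩ := h.local_unit x
    have : x * e i = ∑ j ∈ F, e j * x * e i := by
      rw [← Finset.sum_mul, ← Finset.sum_mul, hF]
    rw [LinearMap.mulRight_apply, this]
    refine Submodule.sum_mem _ fun j _ => ?_
    obtain ⟨c, hc, -⟩ := exists_smul_of_mem_zero (e := e) hx i j
    rw [hc]
    exact Submodule.smul_mem _ _ (Submodule.mem_span_singleton_self _)
  | succ t ih =>
    obtain ⟨S, hS⟩ := ih
    choose F hF using fun x : A => h.local_unit x
    let G : Finset V := S.biUnion F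
    have hG : ∀ x ∈ (𝒜 t).map (LinearMap.mulRight k (e i)), (∑ j ∈ G, e j) * x = x := by
      intro x hx
      rw [← hS] at hx
      induction hx using Submodule.span_induction with
      | mem x hx =>
        exact sum_idem_mul_of_subset 𝒜 (Finset.subset_biUnion_of_mem F hx) (hF x).1
      | zero => simp
      | add x y _ _ hx hy => rw [mul_add, hx, hy]
      | smul c x _ hx => rw [mul_smul_comm, hx]
    let W : Submodule k A := ⨆ j ∈ G, Submodule.span k {x | ∃ a ∈ 𝒜 1, x = a * e j}
    have hW : W.FG := Submodule.fg_biSup _ _ fun j _ => h.finite_out j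
    refine Submodule.FG.of_le (Submodule.FG.map₂ (LinearMap.mul k A) hW ⟨S, hS⟩) ?_
    rw [h.generated, Submodule.map_span, Submodule.span_le]
    rintro _ ⟨_, ⟨a, ha, b, hb, rfl⟩, rfl⟩
    have hb' : b * e i ∈ (𝒜 t).map (LinearMap.mulRight k (e i)) := ⟨b, hb, rfl⟩
    rw [LinearMap.mulRight_apply, mul_assoc, ← hG _ hb', ← mul_assoc, Finset.mul_sum]
    refine Submodule.apply_mem_map₂ (LinearMap.mul k A) (Submodule.sum_mem _ fun j hj => ?_) hb'
    exact Submodule.mem_iSup_of_mem j (Submodule.mem_iSup_of_mem hj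
      (Submodule.subset_span ⟨a, ha, rfl⟩))

/-- If `Λ_t = 0` for `t > N`, then every `Λ ε`, where `ε` is a finite sum of the idempotents
`e_i`, has finite dimension. -/
theorem finite_mulRight_sum {N : ℕ} (hN : ∀ t, N < t → 𝒜 t = ⊥) (F : Finset V) :
    (LinearMap.range (LinearMap.mulRight k (∑ i ∈ F, e i))).FG := by
  have hfg : (⨆ t ∈ Finset.range (N + 1), ⨆ i ∈ F, (𝒜 t).map (LinearMap.mulRight k (e i))).FG :=
    Submodule.fg_biSup _ _ fun t _ => Submodule.fg_biSup _ _ fun i _ => finite_mulRight t i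
  refine Submodule.FG.of_le hfg ?_
  rintro _ ⟨x, rfl⟩
  induction x using homogeneous_induction 𝒜 e with
  | mem t x hx =>
    by_cases ht : t < N + 1
    · rw [LinearMap.mulRight_apply, Finset.mul_sum]
      refine Submodule.sum_mem _ fun i hi => ?_
      exact Submodule.mem_iSup_of_mem t (Submodule.mem_iSup_of_mem (Finset.mem_range.2 ht)
        (Submodule.mem_iSup_of_mem i (Submodule.mem_iSup_of_mem hi ⟨x, hx, rfl⟩)))
    · rw [hN t (by omega), Submodule.mem_bot] at hx
      simp [hx]
  | zero => simp
  | add x y hx hy => rw [map_add]; exact add_mem hx hy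

end GradedAlgebra

/-! ### Paths of the bound quiver -/

section Paths

variable {k A V : Type u} [Field k] [NonUnitalRing A] [Module k A]
  [IsScalarTower k A A] [SMulCommClass k A A]
  {𝒜 : ℕ → Submodule k A} {e : V → A} [h : IsLocFinGraded 𝒜 e]

theorem exists_arrowSystem (𝒜 : ℕ → Submodule k A) (e : V → A) : Nonempty (ArrowSystem 𝒜 e) := by
  choose b hb1 hb2 hb3 using fun i j : V =>
    exists_linearIndependent k (piece 𝒜 e 1 i j : Set A)
  exact ⟨⟨b, fun i j => hb3 i j, fun i j => by rw [hb2 i j, Submodule.span_eq]⟩⟩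

namespace ArrowSystem

variable (Q : ArrowSystem 𝒜 e)

/-- The trivial path at `i`. -/
def nil (i : V) : Q.Path i i := @Quiver.Path.nil V Q.quiver i

/-- The path which runs through `p` and then through the arrow `α`. -/
def cons {i j l : V} (p : Q.Path i j) (α : Q.arr j l) : Q.Path i l :=
  @Quiver.Path.cons V Q.quiver i j l p α

theorem eval_nil (i : V) : Q.eval (Q.nil i) = e i := rfl

theorem len_cons {i j l : V} (p : Q.Path i j) (α : Q.arr j l) :
    Q.len (Q.cons p α) = Q.len p + 1 := rfl

theorem arr_mem_piece {i j : V} (α : Q.arr i j) : (α : A) ∈ piece 𝒜 e 1 i j := by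
  rw [← Q.span_arr]
  exact Submodule.subset_span α.2

theorem eval_mem_piece {i j : V} (p : Q.Path i j) : Q.eval p ∈ piece 𝒜 e (Q.len p) i j := by
  let := Q.quiver
  induction p with
  | nil => exact idem_mem_piece i
  | cons p α ih =>
    have := mul_mem_piece (Q.arr_mem_piece α) ih
    rw [add_comm] at this
    exact this

theorem eval_concat {i j l : V} (p : Q.Path i j) (q : Q.Path j l) :
    Q.eval (Q.concat p q) = Q.eval q * Q.eval p := by
  let := Q.quiver
  induction q with
  | nil => exact (Q.eval_mem_piece p).2.1.symm
  | cons q α ih =>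
    change (α.1 : A) * Q.eval (Q.concat p q) = (α.1 * Q.eval q) * Q.eval p
    rw [ih, mul_assoc]

theorem len_concat {i j l : V} (p : Q.Path i j) (q : Q.Path j l) :
    Q.len (Q.concat p q) = Q.len p + Q.len q :=
  @Quiver.Path.length_comp V Q.quiver i j p l q

theorem eq_of_len_eq_zero {i j : V} (p : Q.Path i j) (hp : Q.len p = 0) : i = j :=
  @Quiver.Path.eq_of_length_zero V Q.quiver i j p hp

/-- The paths of length `t` from `i` to `j` span `e_j Λ_t e_i`, since `Λ` is generated by `Λ₀`
and `Λ₁`. -/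
theorem span_eval (t : ℕ) (i j : V) :
    Submodule.span k (Q.eval '' {p : Q.Path i j | Q.len p = t}) = piece 𝒜 e t i j := by
  refine le_antisymm (Submodule.span_le.2 ?_) ?_
  · rintro _ ⟨p, rfl, rfl⟩
    exact Q.eval_mem_piece p
  induction t generalizing j with
  | zero =>
    intro x hx
    obtain ⟨c, hc, hc'⟩ := exists_smul_of_mem_zero (e := e) hx.1 i j
    rw [hx.2.1, hx.2.2] at hc
    by_cases hij : j = i
    · subst hij
      rw [hc]
      exact Submodule.smul_mem _ _ (Submodule.subset_span ⟨Q.nil j, rfl, rfl⟩)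
    · rw [hc, hc' hij, zero_smul]
      exact zero_mem _
  | succ t ih =>
    have key : ∀ x ∈ 𝒜 (t + 1), e j * x * e i ∈
        Submodule.span k (Q.eval '' {p : Q.Path i j | Q.len p = t + 1}) := by
      intro x hx
      rw [h.generated] at hx
      induction hx using Submodule.span_induction with
      | mem x hx =>
        obtain ⟨a, ha, b, hb, rfl⟩ := hx
        obtain ⟨F, hF, -⟩ := h.local_unit b
        have : e j * (a * b) * e i = ∑ l ∈ F, (e j * a * e l) * (e l * b * e i) := by
          have h1 : ∀ l, (e j * a * e l) * (e l * b * e i) = e j * (a * (e l * b)) * e i := by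
            intro l
            simp only [mul_assoc]
            rw [← mul_assoc (e l) (e l), h.idem]
          simp_rw [h1, ← Finset.sum_mul, ← Finset.mul_sum, ← Finset.sum_mul, hF]
        rw [this]
        refine Submodule.sum_mem _ fun l _ => ?_
        have h2 := ih l (sandwich_mem_piece hb i l)
        have h3 := sandwich_mem_piece (e := e) ha l j
        rw [← Q.span_arr] at h3
        have h4 := Submodule.apply_mem_map₂ (LinearMap.mul k A) h3 h2
        rw [Submodule.map₂_span_span] at h4
        refine Submodule.span_mono ?_ h4
        rintro _ ⟨α, hα, _, ⟨p, hp, rfl⟩, rfl⟩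
        exact ⟨Q.cons p ⟨α, hα⟩, by rw [Set.mem_ofPred_eq, Q.len_cons, hp], rfl⟩
      | zero => simp
      | add x y _ _ hx hy => rw [mul_add, add_mul]; exact add_mem hx hy
      | smul c x _ hx =>
        rw [mul_smul_comm, smul_mul_assoc]
        exact Submodule.smul_mem _ _ hx
    intro x hx
    have := key x hx.1
    rwa [hx.2.1, hx.2.2] at this

theorem exists_evalLin_eq {t : ℕ} {i j : V} {x : A} (hx : x ∈ piece 𝒜 e t i j) :
    ∃ X : Q.Path i j →₀ k, (∀ p ∈ X.support, Q.len p = t) ∧ Q.evalLin X = x := by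
  rw [← Q.span_eval, Finsupp.mem_span_image_iff_linearCombination] at hx
  obtain ⟨X, hX, hX'⟩ := hx
  exact ⟨X, fun p hp => hX hp, hX'⟩

theorem evalLin_mem_piece {t : ℕ} {i j : V} (X : Q.Path i j →₀ k)
    (hX : ∀ p ∈ X.support, Q.len p = t) : Q.evalLin X ∈ piece 𝒜 e t i j :=
  Submodule.sum_mem _ fun p hp => Submodule.smul_mem _ _ (by
    rw [← hX p hp]
    exact Q.eval_mem_piece p)

/-- A linear map which does not vanish on `e_j Λ_t e_i` does not vanish on some path. -/
theorem exists_path_ne_zero {t : ℕ} {i j : V} {x : A} (hx : x ∈ piece 𝒜 e t i j)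
    {M : Type*} [AddCommGroup M] [Module k M] (f : A →ₗ[k] M) (hf : f x ≠ 0) :
    ∃ p : Q.Path i j, Q.len p = t ∧ f (Q.eval p) ≠ 0 := by
  by_contra! hc
  rw [← Q.span_eval] at hx
  have : Submodule.span k (Q.eval '' {p : Q.Path i j | Q.len p = t}) ≤ LinearMap.ker f := by
    rw [Submodule.span_le]
    rintro _ ⟨p, hp, rfl⟩
    exact hc p hp
  exact hf (this hx)

theorem len_le_of_isBound {N : ℕ} (hN : ∀ t, N < t → 𝒜 t = ⊥) {i j : V} {p : Q.Path i j}
    (hp : Q.IsBound p) : Q.len p ≤ N := by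
  by_contra! hc
  have := (Q.eval_mem_piece p).1
  rw [hN _ hc, Submodule.mem_bot] at this
  exact hp this

end ArrowSystem

end Paths

/-! ### Extension of homomorphisms to injective modules -/

section Injective

variable {k A : Type u} [Field k] [NonUnitalRing A] [Module k A]
  [IsScalarTower k A A] [SMulCommClass k A A]

/-- If `s ∈ A ε` and `s' ∈ A ε'` span one-dimensional submodules on which `A` acts through the
same character, then by injectivity of `A ε'` the map `s ↦ s'` extends to a homomorphism
`A ε → A ε'`, which is the right multiplication by some element of `A`. -/
theorem exists_mul_eq_of_isInjective {ε ε' s s' : A} (hε : ε * ε = ε)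
    (hinj : (leftIdeal k ε').IsInjective)
    (hunit : ∀ x : A, ∃ u : A, u * x = x) (hs : s * ε = s) (hs' : s' * ε' = s') (hs0 : s ≠ 0)
    (hact : ∀ a : A, ∃ c : k, a * s = c • s ∧ a * s' = c • s') : ∃ y : A, s * y = s' := by
  obtain ⟨ψ, hψ⟩ : ∃ ψ : Module.Dual k A, ψ s ≠ 0 := by
    by_contra! hc
    exact hs0 ((Module.forall_dual_apply_eq_zero_iff k s).1 hc)
  -- The character through which `A` acts on `s` and `s'`; the module `X` is `k` with this action.
  let χ : A →ₗ[k] k := (ψ s)⁻¹ • ψ ∘ₗ LinearMap.mulRight k s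
  have hχ : ∀ (a : A) (c : k), a * s = c • s → χ a = c := by
    intro a c hac
    simp only [χ, LinearMap.smul_apply, LinearMap.comp_apply, LinearMap.mulRight_apply, hac,
      map_smul, smul_eq_mul]
    field_simp
  have hχs : ∀ a, a * s = χ a • s := fun a => by
    obtain ⟨c, hc, -⟩ := hact a
    rw [hχ a c hc, hc]
  have hχs' : ∀ a, a * s' = χ a • s' := fun a => by
    obtain ⟨c, hc, hc'⟩ := hact a
    rw [hχ a c hc, hc']
  let X : LMod k A :=
    { carrier := k
      act := LinearMap.lsmul k k ∘ₗ χ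
      act_mul := fun a b m => by
        have : χ (a * b) = χ a * χ b := hχ _ _ (by
          rw [mul_assoc, hχs b, mul_smul_comm, hχs a, smul_smul, mul_comm])
        simp [this, mul_assoc] }
  have hX : X.IsUnital := by
    obtain ⟨u, hu⟩ := hunit s
    have hu' : χ u = 1 := hχ u 1 (by rw [hu, one_smul])
    refine eq_top_iff.2 fun m _ => Submodule.subset_span ⟨u, m, ?_⟩
    change m = χ u • m
    rw [hu', one_smul]
  have hY : (leftIdeal k ε).IsUnital := by
    refine eq_top_iff.2 fun m _ => Submodule.subset_span ?_
    obtain ⟨u, hu⟩ := hunit m.1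
    exact ⟨u, m, Subtype.ext hu.symm⟩
  have hmem : ∀ {η x : A}, x * η = x → x ∈ LinearMap.ker (LinearMap.mulRight k η - LinearMap.id) :=
    fun hx => by simp [hx]
  let f : LHom X (leftIdeal k ε) :=
    { toLin := LinearMap.toSpanSingleton k _ ⟨s, hmem hs⟩
      map_act := fun a m => Subtype.ext (by
        change (χ a • (m : k)) • s = a * ((m : k) • s)
        rw [mul_smul_comm, hχs a, smul_comm, smul_assoc]) }
  let g : LHom X (leftIdeal k ε') :=
    { toLin := LinearMap.toSpanSingleton k _ ⟨s', hmem hs'⟩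
      map_act := fun a m => Subtype.ext (by
        change (χ a • (m : k)) • s' = a * ((m : k) • s')
        rw [mul_smul_comm, hχs' a, smul_comm, smul_assoc]) }
  have hf : Function.Injective f.toLin := by
    intro a b hab
    have : (a : k) • s = (b : k) • s := congrArg Subtype.val hab
    exact smul_left_injective k hs0 this
  obtain ⟨H, hH⟩ := hinj X (leftIdeal k ε) hX hY f g hf
  let E : (leftIdeal k ε).carrier := ⟨ε, hmem hε⟩
  refine ⟨(H.toLin E).1, ?_⟩
  have h1 : (leftIdeal k ε).act s E = f.toLin (1 : k) := Subtype.ext (by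
    change s * ε = (1 : k) • s
    rw [hs, one_smul])
  have h2 := congrArg Subtype.val (H.map_act s E)
  rw [h1, hH] at h2
  have h3 : ((g.toLin (1 : k)).1 : A) = s' := one_smul k s'
  exact h2.symm.trans h3

end Injective

/-! ### Self-injective translation algebras have no projective or injective vertices -/

section Vertices

variable {k A V : Type u} [Field k] [NonUnitalRing A] [Module k A]
  [IsScalarTower k A A] [SMulCommClass k A A]
  {𝒜 : ℕ → Submodule k A} {e : V → A} [h : IsLocFinGraded 𝒜 e]

/-- On elements `s = e_j s` which are killed by all the components of positive degree, `Λ` acts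
from the left by the character of the vertex `j`. -/
theorem exists_character_left (𝒜 : ℕ → Submodule k A) {e : V → A} [h : IsLocFinGraded 𝒜 e]
    (j : V) (a : A) : ∃ c : k, ∀ s : A, e j * s = s →
      (∀ t, ∀ b ∈ 𝒜 (t + 1), b * s = 0) → a * s = c • s := by
  induction a using homogeneous_induction 𝒜 e with
  | mem t a ha =>
    cases t with
    | zero =>
      rw [← h.span_zero] at ha
      induction ha using Submodule.span_induction with
      | mem a ha =>
        obtain ⟨i, rfl⟩ := ha
        by_cases hij : i = j
        · subst hij
          exact ⟨1, fun s hs _ => by rw [hs, one_smul]⟩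
        · exact ⟨0, fun s hs _ => by rw [← hs, ← mul_assoc, h.orth i j hij, zero_mul, zero_smul]⟩
      | zero => exact ⟨0, by simp⟩
      | add x y _ _ hx hy =>
        obtain ⟨c, hc⟩ := hx
        obtain ⟨d, hd⟩ := hy
        exact ⟨c + d, fun s h1 h2 => by rw [add_mul, hc s h1 h2, hd s h1 h2, add_smul]⟩
      | smul r x _ hx =>
        obtain ⟨c, hc⟩ := hx
        exact ⟨r * c, fun s h1 h2 => by rw [smul_mul_assoc, hc s h1 h2, mul_smul]⟩
    | succ t => exact ⟨0, fun s _ hs => by rw [hs t a ha, zero_smul]⟩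
  | zero => exact ⟨0, by simp⟩
  | add x y hx hy =>
    obtain ⟨c, hc⟩ := hx
    obtain ⟨d, hd⟩ := hy
    exact ⟨c + d, fun s h1 h2 => by rw [add_mul, hc s h1 h2, hd s h1 h2, add_smul]⟩

/-- On elements `s = s e_j` which are killed by all the components of positive degree, `Λ` acts
from the right by the character of the vertex `j`. -/
theorem exists_character_right (𝒜 : ℕ → Submodule k A) {e : V → A} [h : IsLocFinGraded 𝒜 e]
    (j : V) (a : A) : ∃ c : k, ∀ s : A, s * e j = s →
      (∀ t, ∀ b ∈ 𝒜 (t + 1), s * b = 0) → s * a = c • s := by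
  induction a using homogeneous_induction 𝒜 e with
  | mem t a ha =>
    cases t with
    | zero =>
      rw [← h.span_zero] at ha
      induction ha using Submodule.span_induction with
      | mem a ha =>
        obtain ⟨i, rfl⟩ := ha
        by_cases hij : j = i
        · subst hij
          exact ⟨1, fun s hs _ => by rw [hs, one_smul]⟩
        · exact ⟨0, fun s hs _ => by rw [← hs, mul_assoc, h.orth j i hij, mul_zero, zero_smul]⟩
      | zero => exact ⟨0, by simp⟩
      | add x y _ _ hx hy =>
        obtain ⟨c, hc⟩ := hx
        obtain ⟨d, hd⟩ := hy
        exact ⟨c + d, fun s h1 h2 => by rw [mul_add, hc s h1 h2, hd s h1 h2, add_smul]⟩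
      | smul r x _ hx =>
        obtain ⟨c, hc⟩ := hx
        exact ⟨r * c, fun s h1 h2 => by rw [mul_smul_comm, hc s h1 h2, mul_smul]⟩
    | succ t => exact ⟨0, fun s _ hs => by rw [hs t a ha, zero_smul]⟩
  | zero => exact ⟨0, by simp⟩
  | add x y hx hy =>
    obtain ⟨c, hc⟩ := hx
    obtain ⟨d, hd⟩ := hy
    exact ⟨c + d, fun s h1 h2 => by rw [mul_add, hc s h1 h2, hd s h1 h2, add_smul]⟩

namespace ArrowSystem

variable (Q : ArrowSystem 𝒜 e)

/-- A path which cannot be prolonged at its end to a bound path is killed by all the components of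
positive degree. -/
theorem mul_eval_eq_zero {i j : V} {p : Q.Path i j}
    (hp : ∀ (l : V) (q : Q.Path j l), Q.IsBound (Q.concat p q) → Q.len q = 0)
    (t : ℕ) (b : A) (hb : b ∈ 𝒜 (t + 1)) : b * Q.eval p = 0 := by
  by_contra hne
  obtain ⟨F, hF, -⟩ := h.local_unit b
  have : ∃ l ∈ F, e l * b * e j * Q.eval p ≠ 0 := by
    by_contra! hc
    refine hne ?_
    rw [← hF, ← (Q.eval_mem_piece p).2.1, Finset.sum_mul, Finset.sum_mul]
    exact Finset.sum_eq_zero fun l hl => by rw [← mul_assoc, hc l hl]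
  obtain ⟨l, -, hl⟩ := this
  obtain ⟨q, hq, hq'⟩ := Q.exists_path_ne_zero (sandwich_mem_piece hb j l)
    (LinearMap.mulRight k (Q.eval p)) hl
  have := hp l q (by rw [IsBound, Q.eval_concat]; exact hq')
  omega

theorem eval_mul_eq_zero {i j : V} {p : Q.Path i j}
    (hp : ∀ (l : V) (q : Q.Path l i), Q.IsBound (Q.concat q p) → Q.len q = 0)
    (t : ℕ) (b : A) (hb : b ∈ 𝒜 (t + 1)) : Q.eval p * b = 0 := by
  by_contra hne
  obtain ⟨F, -, hF⟩ := h.local_unit b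
  have : ∃ l ∈ F, Q.eval p * (e i * b * e l) ≠ 0 := by
    by_contra! hc
    refine hne ?_
    rw [← hF, ← (Q.eval_mem_piece p).2.2, Finset.mul_sum, Finset.mul_sum]
    exact Finset.sum_eq_zero fun l hl => by rw [mul_assoc, ← mul_assoc (e i), hc l hl]
  obtain ⟨l, -, hl⟩ := this
  obtain ⟨q, hq, hq'⟩ := Q.exists_path_ne_zero (sandwich_mem_piece hb l i)
    (LinearMap.mulLeft k (Q.eval p)) hl
  have := hp l q (by rw [IsBound, Q.eval_concat]; exact hq')
  omega

/-- Every bound path can be prolonged at its end to a bound path which cannot be prolonged there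
any further. -/
theorem exists_max_left {N : ℕ} (hN : ∀ t, N < t → 𝒜 t = ⊥) {i j : V} (p : Q.Path i j)
    (hp : Q.IsBound p) : ∃ (l : V) (q : Q.Path j l), Q.IsBound (Q.concat p q) ∧
      ∀ (l' : V) (q' : Q.Path l l'), Q.IsBound (Q.concat (Q.concat p q) q') → Q.len q' = 0 := by
  let S : Set ℕ := {m | ∃ (l : V) (q : Q.Path j l), Q.IsBound (Q.concat p q) ∧ Q.len q = m}
  have hS : S.Nonempty := ⟨0, j, Q.nil j, hp, rfl⟩
  have hb : BddAbove S := by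
    refine ⟨N, ?_⟩
    rintro _ ⟨l, q, hq, rfl⟩
    have := Q.len_le_of_isBound hN hq
    rw [Q.len_concat] at this
    omega
  obtain ⟨l, q, hq, hq'⟩ := Nat.sSup_mem hS hb
  refine ⟨l, q, hq, fun l' q' h' => ?_⟩
  have : Q.len (Q.concat q q') ≤ sSup S := le_csSup hb ⟨l', Q.concat q q', by
    rwa [IsBound, Q.eval_concat, Q.eval_concat, mul_assoc, ← Q.eval_concat, ← Q.eval_concat], rfl⟩
  rw [Q.len_concat, hq'] at this
  omega

theorem exists_max_right {N : ℕ} (hN : ∀ t, N < t → 𝒜 t = ⊥) {i j : V} (p : Q.Path i j)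
    (hp : Q.IsBound p) : ∃ (l : V) (q : Q.Path l i), Q.IsBound (Q.concat q p) ∧
      ∀ (l' : V) (q' : Q.Path l' l), Q.IsBound (Q.concat q' (Q.concat q p)) → Q.len q' = 0 := by
  let S : Set ℕ := {m | ∃ (l : V) (q : Q.Path l i), Q.IsBound (Q.concat q p) ∧ Q.len q = m}
  have hS : S.Nonempty := ⟨0, i, Q.nil i, by
    rw [IsBound, Q.eval_concat, Q.eval_nil, (Q.eval_mem_piece p).2.2]; exact hp, rfl⟩
  have hb : BddAbove S := by
    refine ⟨N, ?_⟩
    rintro _ ⟨l, q, hq, rfl⟩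
    have := Q.len_le_of_isBound hN hq
    rw [Q.len_concat] at this
    omega
  obtain ⟨l, q, hq, hq'⟩ := Nat.sSup_mem hS hb
  refine ⟨l, q, hq, fun l' q' h' => ?_⟩
  have : Q.len (Q.concat q' q) ≤ sSup S := le_csSup hb ⟨l', Q.concat q' q, by
    rwa [IsBound, Q.eval_concat, Q.eval_concat, ← mul_assoc, ← Q.eval_concat, ← Q.eval_concat], rfl⟩
  rw [Q.len_concat, hq'] at this
  omega

variable {Q}

/-- An equation `p = z` with `p` a bound path of length `t` and `z` in `Λ_{s+t} Λ` or
`Λ Λ_{s+t}` is only possible for `s = 0`. -/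
theorem eq_zero_of_mul_mem {s t : ℕ} {x z y : A} (hx0 : x ≠ 0) (hx : x ∈ 𝒜 t)
    (hz : z ∈ 𝒜 (s + t)) (e : V → A) [IsLocFinGraded 𝒜 e] (hy : z * y = x ∨ y * z = x) : s = 0 := by
  by_contra hs
  refine hx0 ?_
  have h1 : ∀ y : A, homProj 𝒜 e t (z * y) = 0 ∧ homProj 𝒜 e t (y * z) = 0 := by
    intro y
    induction y using homogeneous_induction 𝒜 e with
    | mem u y hy =>
      have h := ‹IsLocFinGraded 𝒜 e›
      exact ⟨homProj_of_mem_of_ne (by omega) (h.mul_mem hz hy),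
        homProj_of_mem_of_ne (by omega) (h.mul_mem hy hz)⟩
    | zero => simp
    | add a b ha hb => simp [mul_add, add_mul, ha, hb]
  rw [← homProj_of_mem (e := e) hx]
  rcases hy with rfl | rfl
  · exact (h1 y).1
  · exact (h1 y).2

variable {n : ℕ} {P I : Set V} {τ : ↥Pᶜ ≃ ↥Iᶜ}

/-- For a self-injective algebra no vertex is injective: a bound path `p` from `i` which cannot be
prolonged at its end lies in a maximal bound path `p q`, and `p = p q y` for some `y` because
`Λ e_i` is injective; so `q` is trivial, and the maximal bound path `p` starts at `i`. -/
theorem IsNTranslationQuiver.notMem_injective (hQ : Q.IsNTranslationQuiver n P I τ)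
    (hN : ∀ t, n + 1 < t → 𝒜 t = ⊥) (hinj : IsSelfInjective (k := k) e) (i : V) : i ∉ I := by
  have hnil : Q.IsBound (Q.nil i) := idem_ne_zero 𝒜 i
  obtain ⟨j, p, hp, hpmax⟩ := Q.exists_max_left hN (Q.nil i) hnil
  have hnp : Q.eval (Q.concat (Q.nil i) p) = Q.eval p := by
    rw [Q.eval_concat, Q.eval_nil, (Q.eval_mem_piece p).2.2]
  rw [IsBound, hnp] at hp
  have hpmax' : ∀ (l : V) (q : Q.Path j l), Q.IsBound (Q.concat p q) → Q.len q = 0 := by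
    intro l q hq
    refine hpmax l q ?_
    rwa [IsBound, Q.eval_concat, hnp, ← Q.eval_concat]
  obtain ⟨l, q, hq, hqmax⟩ := Q.exists_max_right hN p hp
  have hpq := Q.eval_concat q p
  have hbot := Q.mul_eval_eq_zero hpmax'
  have hmax : Q.IsMaximalBound (Q.concat q p) := by
    refine ⟨hq, fun i' j' q'' q' hb => ?_⟩
    rw [IsBound, Q.eval_concat, Q.eval_concat] at hb
    constructor
    · refine hqmax i' q'' ?_
      rw [IsBound, Q.eval_concat]
      exact right_ne_zero_of_mul hb
    · refine hpmax' j' q' ?_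
      rw [IsBound, Q.eval_concat]
      intro h0
      rw [Q.eval_concat, ← mul_assoc, ← mul_assoc, h0, zero_mul, zero_mul] at hb
      exact hb rfl
  obtain ⟨-, hj, hτ⟩ := hQ.maximal l j _ hmax
  obtain ⟨y, hy⟩ := exists_mul_eq_of_isInjective (k := k) (h.idem l) (hinj.1 i)
    (fun x => ⟨_, (h.local_unit x).choose_spec.1⟩) (Q.eval_mem_piece (Q.concat q p)).2.2
    (Q.eval_mem_piece p).2.2 hq (fun a => by
      obtain ⟨c, hc⟩ := exists_character_left 𝒜 (e := e) j a
      refine ⟨c, hc _ (Q.eval_mem_piece (Q.concat q p)).2.1 fun t b hb => ?_,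
        hc _ (Q.eval_mem_piece p).2.1 hbot⟩
      rw [hpq, ← mul_assoc, hbot t b hb, zero_mul])
  have hlen : Q.len q = 0 := by
    refine eq_zero_of_mul_mem hp (Q.eval_mem_piece p).1 ?_ e (Or.inl hy)
    have := (Q.eval_mem_piece (Q.concat q p)).1
    rwa [Q.len_concat] at this
  have hli := Q.eq_of_len_eq_zero q hlen
  rw [← hli, ← hτ]
  exact (τ ⟨j, hj⟩).2

/-- For a self-injective algebra no vertex is projective: the mirror image of the argument for
injective vertices, with the injectivity of the right module `e_i Λ`. -/
theorem IsNTranslationQuiver.notMem_projective (hQ : Q.IsNTranslationQuiver n P I τ)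
    (hN : ∀ t, n + 1 < t → 𝒜 t = ⊥) (hinj : IsSelfInjective (k := k) e) (i : V) : i ∉ P := by
  have hnil : Q.IsBound (Q.nil i) := idem_ne_zero 𝒜 i
  obtain ⟨j, p, hp, hpmax⟩ := Q.exists_max_right hN (Q.nil i) hnil
  have hnp : Q.eval (Q.concat p (Q.nil i)) = Q.eval p := rfl
  rw [IsBound, hnp] at hp
  have hpmax' : ∀ (l : V) (q : Q.Path l j), Q.IsBound (Q.concat q p) → Q.len q = 0 := hpmax
  obtain ⟨l, q, hq, hqmax⟩ := Q.exists_max_left hN p hp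
  have hpq := Q.eval_concat p q
  have hbot := Q.eval_mul_eq_zero hpmax'
  have hmax : Q.IsMaximalBound (Q.concat p q) := by
    refine ⟨hq, fun i' j' q'' q' hb => ?_⟩
    rw [IsBound, Q.eval_concat, Q.eval_concat] at hb
    constructor
    · refine hpmax' i' q'' ?_
      rw [IsBound, Q.eval_concat]
      intro h0
      rw [Q.eval_concat, mul_assoc, h0, mul_zero, mul_zero] at hb
      exact hb rfl
    · refine hqmax j' q' ?_
      rw [IsBound, Q.eval_concat]
      intro h0
      rw [← mul_assoc, h0, zero_mul] at hb
      exact hb rfl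
  obtain ⟨-, hj, -⟩ := hQ.maximal j l _ hmax
  have hop : ∀ {a b : A}, a * b = b → MulOpposite.op b * MulOpposite.op a = MulOpposite.op b :=
    fun hab => by rw [← MulOpposite.op_mul, hab]
  obtain ⟨y, hy⟩ := exists_mul_eq_of_isInjective (k := k) (hop (h.idem l)) (hinj.2 i)
    (fun x => ⟨MulOpposite.op (∑ i ∈ (h.local_unit x.unop).choose, e i), by
      rw [← MulOpposite.op_unop x, ← MulOpposite.op_mul, (h.local_unit x.unop).choose_spec.2]⟩)
    (hop (Q.eval_mem_piece (Q.concat p q)).2.1)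
    (hop (Q.eval_mem_piece p).2.1) (fun h0 => hq (MulOpposite.op_injective h0)) (fun a => by
      obtain ⟨c, hc⟩ := exists_character_right 𝒜 (e := e) j a.unop
      refine ⟨c, MulOpposite.unop_injective
        (hc _ (Q.eval_mem_piece (Q.concat p q)).2.2 fun t b hb => ?_),
        MulOpposite.unop_injective (hc _ (Q.eval_mem_piece p).2.2 hbot)⟩
      change Q.eval (Q.concat p q) * b = 0
      rw [hpq, mul_assoc, hbot t b hb, mul_zero])
  have hlen : Q.len q = 0 := by
    refine eq_zero_of_mul_mem hp (Q.eval_mem_piece p).1 ?_ e (Or.inr (congrArg MulOpposite.unop hy))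
    have := (Q.eval_mem_piece (Q.concat p q)).1
    rwa [Q.len_concat, add_comm] at this
  have hli := Q.eq_of_len_eq_zero q hlen
  rw [hli]
  exact hj

end ArrowSystem

/-- The part of the structure of an `n`-translation algebra with translation `τ`, defined at all
vertices, from which its Frobenius form is built: `Λ_t = 0` for `t > n + 1`, every nonzero element
of `e_i Λ_t e_j` can be multiplied from the right, and every nonzero element of `e_j Λ_t e_{τ i}`
from the left, to a nonzero element of the space `e_i Λ_{n+1} e_{τ i}`, and this space is
one-dimensional with basis `w i`. -/
structure IsTopNondegenerate (𝒜 : ℕ → Submodule k A) (e : V → A) (n : ℕ) (τ : V ≃ V)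
    (w : V → A) : Prop where
  eq_bot : ∀ t, n + 1 < t → 𝒜 t = ⊥
  right : ∀ (i j : V) (t : ℕ) (x : A), x ∈ piece 𝒜 e t j i → x ≠ 0 →
    ∃ s, s + t = n + 1 ∧ ∃ y ∈ piece 𝒜 e s (τ i) j, x * y ≠ 0
  left : ∀ (i j : V) (t : ℕ) (x : A), x ∈ piece 𝒜 e t (τ i) j → x ≠ 0 →
    ∃ s, s + t = n + 1 ∧ ∃ y ∈ piece 𝒜 e s j i, y * x ≠ 0
  mem : ∀ i, w i ∈ piece 𝒜 e (n + 1) (τ i) i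
  ne_zero : ∀ i, w i ≠ 0
  exists_smul : ∀ i, ∀ x ∈ piece 𝒜 e (n + 1) (τ i) i, ∃ c : k, x = c • w i

theorem exists_isTopNondegenerate {n : ℕ} (hinj : IsSelfInjective (k := k) e)
    (ht : IsNTranslationAlgebra 𝒜 e n) :
    ∃ (τ : V ≃ V) (w : V → A), IsTopNondegenerate 𝒜 e n τ w := by
  obtain ⟨-, ⟨Q, P, I, τ, hQ⟩, l, hbot, -⟩ := ht
  have hN : ∀ t, n + 1 < t → 𝒜 t = ⊥ := fun t ht => hbot t (by exact_mod_cast ht)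
  have hP := hQ.notMem_projective hN hinj
  have hI := hQ.notMem_injective hN hinj
  let τ' : V ≃ V := (Equiv.subtypeUnivEquiv hP).symm.trans (τ.trans (Equiv.subtypeUnivEquiv hI))
  choose p hp hp' using hQ.exists_bound
  have hvanish : ∀ {i j : V} {t : ℕ} {x : A}, x ∈ piece 𝒜 e t i j → x ≠ 0 → t ≤ n + 1 := by
    intro i j t x hx hx0
    by_contra! hc
    have := hx.1
    rw [hN t hc, Submodule.mem_bot] at this
    exact hx0 this
  refine ⟨τ', fun i => Q.eval (p ⟨i, hP i⟩), hN, ?_, ?_, ?_, fun i => hp' _, ?_⟩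
  · intro i j t x hx hx0
    obtain ⟨X, hX, rfl⟩ := Q.exists_evalLin_eq hx
    obtain ⟨q, hq, hq'⟩ := hQ.extend_right ⟨i, hP i⟩ j t X (hvanish hx hx0) hX hx0
    exact ⟨_, hq, _, Q.eval_mem_piece q, hq'⟩
  · intro i j t x hx hx0
    have hx' : x ∈ piece 𝒜 e t (τ ⟨i, hP i⟩ : V) j := hx
    obtain ⟨X, hX, hX'⟩ := Q.exists_evalLin_eq hx'
    obtain ⟨q, hq, hq'⟩ := hQ.extend_left (τ ⟨i, hP i⟩) j t X (hvanish hx hx0) hX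
      (by rw [hX']; exact hx0)
    rw [hX'] at hq'
    have hi : (τ.symm (τ ⟨i, hP i⟩) : V) = i := by rw [Equiv.symm_apply_apply]
    have hmem := Q.eval_mem_piece q
    refine ⟨_, hq, Q.eval q, ⟨hmem.1, ?_, hmem.2.2⟩, hq'⟩
    rw [← congrArg e hi]
    exact hmem.2.1
  · intro i
    have := Q.eval_mem_piece (p ⟨i, hP i⟩)
    rwa [hp] at this
  · intro i x hx
    rw [← Q.span_eval] at hx
    refine Submodule.mem_span_singleton.1 ((Submodule.span_le.2 ?_) hx) |>.imp fun _ => Eq.symm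
    rintro _ ⟨q, hq, rfl⟩
    by_cases hq0 : Q.eval q = 0
    · rw [hq0]; exact zero_mem _
    have hdep := hQ.dependent ⟨i, hP i⟩ (p ⟨i, hP i⟩) q (hp _) hq (hp' _) hq0
    rw [LinearIndependent.pair_iff' (hp' _)] at hdep
    push Not at hdep
    obtain ⟨c, hc⟩ := hdep
    exact Submodule.mem_span_singleton.2 ⟨c, hc⟩

end Vertices

/-! ### The Frobenius form and the Nakayama automorphism -/

section FrobeniusForm

variable {k A V : Type u} [Field k] [NonUnitalRing A] [Module k A]
  [IsScalarTower k A A] [SMulCommClass k A A]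
  {𝒜 : ℕ → Submodule k A} {e : V → A} [h : IsLocFinGraded 𝒜 e]

/-- A nondegenerate linear form `φ` on `Λ`, nonzero only on the spaces `e_i Λ_{n+1} e_{τ i}`, for an
algebra with `Λ_t = 0` for `t > n + 1`. If there are infinitely many vertices, it does not belong
to `D_* Λ`, but all the forms `φ(a ·)` and `φ(· a)` do. -/
structure IsFrobeniusForm (𝒜 : ℕ → Submodule k A) (e : V → A) (n : ℕ) (τ : V ≃ V)
    (φ : A →ₗ[k] k) : Prop where
  eq_bot : ∀ t, n + 1 < t → 𝒜 t = ⊥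
  eq_zero : ∀ t, t ≠ n + 1 → ∀ x ∈ 𝒜 t, φ x = 0
  swap : ∀ (i : V) (x : A), φ (x * e (τ i)) = φ (e i * x)
  nondeg_left : ∀ a, (∀ z, φ (a * z) = 0) → a = 0
  nondeg_right : ∀ a, (∀ z, φ (z * a) = 0) → a = 0

/-- The paths of length `n + 1` which end at `i` start at `τ i`. -/
theorem IsTopNondegenerate.eq_zero_of_ne {n : ℕ} {τ : V ≃ V} {w : V → A}
    (hT : IsTopNondegenerate 𝒜 e n τ w) {i j : V} {x : A} (hx : x ∈ piece 𝒜 e (n + 1) j i)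
    (hj : τ i ≠ j) : x = 0 := by
  by_contra hx0
  obtain ⟨s, hs, y, hy, hxy⟩ := hT.right i j _ x hx hx0
  obtain rfl : s = 0 := by omega
  exact hj (eq_of_mem_piece_zero hy (right_ne_zero_of_mul hxy))

theorem IsTopNondegenerate.linearIndependent {n : ℕ} {τ : V ≃ V} {w : V → A}
    (hT : IsTopNondegenerate 𝒜 e n τ w) : LinearIndependent k w := by
  classical
  rw [linearIndependent_iff']
  intro s g hg i hi
  have h1 : e i * ∑ j ∈ s, g j • w j = g i • w i := by
    rw [Finset.mul_sum, Finset.sum_eq_single_of_mem i hi, mul_smul_comm, (hT.mem i).2.1]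
    intro j _ hj
    rw [mul_smul_comm, ← (hT.mem j).2.1, ← mul_assoc, h.orth i j (Ne.symm hj), zero_mul, smul_zero]
  rw [hg, mul_zero, eq_comm, smul_eq_zero] at h1
  exact h1.resolve_right (hT.ne_zero i)

theorem apply_homProj_of_eq_zero {n : ℕ} {φ : A →ₗ[k] k}
    (hφ : ∀ t, t ≠ n → ∀ x ∈ 𝒜 t, φ x = 0) (x : A) : φ (homProj 𝒜 e n x) = φ x := by
  induction x using homogeneous_induction 𝒜 e with
  | mem t x hx =>
    by_cases ht : t = n
    · subst ht
      rw [homProj_of_mem hx]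
    · rw [homProj_of_mem_of_ne ht hx, hφ t ht x hx, map_zero]
  | zero => simp
  | add x y hx hy => rw [map_add, map_add, map_add, hx, hy]

/-- The form is chosen to be `1` on the basis elements `w i` of the spaces `e_i Λ_{n+1} e_{τ i}`. -/
theorem IsTopNondegenerate.exists_isFrobeniusForm {n : ℕ} {τ : V ≃ V} {w : V → A}
    (hT : IsTopNondegenerate 𝒜 e n τ w) : ∃ φ : A →ₗ[k] k, IsFrobeniusForm 𝒜 e n τ φ := by
  obtain ⟨ψ, hψ⟩ := LinearMap.exists_extend
    ((Module.Basis.span hT.linearIndependent).constr k fun _ => (1 : k))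
  have hψw : ∀ i, ψ (w i) = 1 := by
    intro i
    have h1 := LinearMap.congr_fun hψ (Module.Basis.span hT.linearIndependent i)
    rw [Module.Basis.constr_basis] at h1
    simpa [Module.Basis.span_apply] using h1
  let φ : A →ₗ[k] k := ψ ∘ₗ homProj 𝒜 e (n + 1)
  have hφ0 : ∀ t, t ≠ n + 1 → ∀ x ∈ 𝒜 t, φ x = 0 := fun t ht x hx => by
    simp only [φ, LinearMap.comp_apply, homProj_of_mem_of_ne ht hx, map_zero]
  have hφw : ∀ i x, x ∈ piece 𝒜 e (n + 1) (τ i) i → x ≠ 0 → φ x ≠ 0 := by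
    intro i x hx hx0 h0
    obtain ⟨c, rfl⟩ := hT.exists_smul i x hx
    simp only [φ, LinearMap.comp_apply, homProj_of_mem (hT.mem i).1, map_smul, hψw, smul_eq_mul,
      mul_one] at h0
    exact hx0 (by rw [h0, zero_smul])
  have hswap : ∀ (i : V) (x : A), φ (x * e (τ i)) = φ (e i * x) := by
    intro i x
    induction x using piece_induction 𝒜 e with
    | mem t j l x hx =>
      by_cases ht : t = n + 1
      · subst ht
        by_cases hjl : τ l = j
        · subst hjl
          by_cases hil : i = l
          · subst hil
            rw [hx.2.1, hx.2.2]
          · rw [← hx.2.1, ← mul_assoc (e i), h.orth i l hil, zero_mul, hx.2.1, ← hx.2.2, mul_assoc,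
              h.orth _ _ (fun hc => hil (τ.injective hc).symm), mul_zero]
        · rw [hT.eq_zero_of_ne hx hjl, zero_mul, mul_zero]
      · have h1 := h.mul_mem hx.1 (idem_mem (𝒜 := 𝒜) (e := e) (τ i))
        have h2 := h.mul_mem (idem_mem (𝒜 := 𝒜) (e := e) i) hx.1
        rw [hφ0 _ (by omega) _ h1, hφ0 _ (by omega) _ h2]
    | zero => simp
    | add x y hx hy => rw [add_mul, mul_add, map_add, map_add, hx, hy]
  refine ⟨φ, hT.eq_bot, hφ0, hswap, fun a ha => ?_, fun a ha => ?_⟩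
  · refine eq_zero_of_homProj_eq_zero (𝒜 := 𝒜) (e := e) fun t => ?_
    by_contra hne
    obtain ⟨j, i, hij⟩ := exists_sandwich_ne_zero 𝒜 e hne
    have hx := sandwich_mem_piece (e := e) (homProj_mem (𝒜 := 𝒜) (e := e) t a) j i
    obtain ⟨s, hs, y, hy, hxy⟩ := hT.right i j t _ hx hij
    have hmem := mul_mem_piece hx hy
    rw [add_comm, hs] at hmem
    refine hφw i _ hmem hxy ?_
    rw [mul_assoc, hy.2.1, mul_assoc, ← hswap, mul_assoc, hy.2.2,
      ← homProj_mul_right (e := e) hy.1, add_comm, hs, apply_homProj_of_eq_zero (e := e) hφ0, ha]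
  · refine eq_zero_of_homProj_eq_zero (𝒜 := 𝒜) (e := e) fun t => ?_
    by_contra hne
    obtain ⟨l, j, hlj⟩ := exists_sandwich_ne_zero 𝒜 e hne
    obtain ⟨i, rfl⟩ := τ.surjective l
    have hx := sandwich_mem_piece (e := e) (homProj_mem (𝒜 := 𝒜) (e := e) t a) (τ i) j
    obtain ⟨s, hs, y, hy, hxy⟩ := hT.left i j t _ hx hlj
    have hmem := mul_mem_piece hy hx
    rw [hs] at hmem
    refine hφw i _ hmem hxy ?_
    rw [← mul_assoc, ← mul_assoc, hy.2.2, hswap, ← mul_assoc, hy.2.1,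
      ← homProj_mul_left (e := e) hy.1, hs, apply_homProj_of_eq_zero (e := e) hφ0, ha]

theorem exists_sum_idem_of_mem_localDual {f : Module.Dual k A} (hf : f ∈ localDual 𝒜 e) :
    ∃ F : Finset V, ∀ z, f ((∑ i ∈ F, e i) * z) = f z ∧ f (z * ∑ i ∈ F, e i) = f z := by
  classical
  obtain ⟨-, F, -, hF⟩ := hf
  refine ⟨F, fun z => ?_⟩
  obtain ⟨G, h1, h2⟩ := h.local_unit z
  have h1' := sum_idem_mul_of_subset 𝒜 (Finset.subset_union_right (s₁ := F)) h1
  have h2' := mul_sum_idem_of_subset 𝒜 (Finset.subset_union_right (s₁ := F)) h2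
  constructor
  · conv_rhs => rw [← h1']
    rw [Finset.sum_mul, Finset.sum_mul, map_sum, map_sum]
    exact Finset.sum_subset Finset.subset_union_left fun j _ hj => (hF j hj z).1
  · conv_rhs => rw [← h2']
    rw [Finset.mul_sum, Finset.mul_sum, map_sum, map_sum]
    exact Finset.sum_subset Finset.subset_union_left fun j _ hj => (hF j hj z).2

namespace IsFrobeniusForm

variable {n : ℕ} {τ : V ≃ V} {φ : A →ₗ[k] k} (hφ : IsFrobeniusForm 𝒜 e n τ φ)
include hφ

theorem eq_zero_of_lt {a : A} (t : ℕ) (ht : n + 1 < t) (ha : a ∈ 𝒜 t) : a = 0 := by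
  rwa [hφ.eq_bot t ht, Submodule.mem_bot] at ha

/-- A form in `D_* Λ` is determined by its restriction to some `Λ ε`, which has finite dimension, so
that by nondegeneracy of `φ` it agrees there with some `φ(a ·)`. -/
theorem exists_eq_apply_mul {f : Module.Dual k A} (hf : f ∈ localDual 𝒜 e) :
    ∃ a, ∀ z, φ (a * z) = f z := by
  obtain ⟨F, hF⟩ := exists_sum_idem_of_mem_localDual hf
  let Y := LinearMap.range (LinearMap.mulRight k (∑ i ∈ F, e i))
  have : FiniteDimensional k Y := Module.Finite.iff_fg.2 (finite_mulRight_sum hφ.eq_bot F)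
  let B : A →ₗ[k] Y →ₗ[k] k := (LinearMap.mul k A).compr₂ φ |>.compl₂ Y.subtype
  have hB : Function.Surjective B := by
    rw [← LinearMap.flip_injective_iff₂]
    refine (injective_iff_map_eq_zero _).2 fun y hy => Subtype.ext (hφ.nondeg_right _ fun z => ?_)
    exact LinearMap.congr_fun hy z
  obtain ⟨a, ha⟩ := hB (f ∘ₗ Y.subtype)
  -- As `φ(a z e_j) = φ(e_{τ⁻¹ j} a z)`, the idempotents can be moved to the left of `a`.
  refine ⟨(∑ j ∈ F, e (τ.symm j)) * a, fun z => ?_⟩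
  have h1 : φ (a * (z * ∑ i ∈ F, e i)) = f (z * ∑ i ∈ F, e i) :=
    LinearMap.congr_fun ha ⟨_, z, rfl⟩
  rw [(hF z).2] at h1
  rw [← h1, ← mul_assoc, Finset.mul_sum, Finset.sum_mul, Finset.sum_mul, map_sum, map_sum]
  refine Finset.sum_congr rfl fun j _ => ?_
  have := hφ.swap (τ.symm j) (a * z)
  rw [Equiv.apply_symm_apply] at this
  rw [this, mul_assoc]

theorem exists_eq_apply_mul' {f : Module.Dual k A} (hf : f ∈ localDual 𝒜 e) :
    ∃ a, ∀ z, φ (z * a) = f z := by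
  obtain ⟨F, hF⟩ := exists_sum_idem_of_mem_localDual hf
  let Y := LinearMap.range (LinearMap.mulRight k (∑ i ∈ F, e i))
  have : FiniteDimensional k Y := Module.Finite.iff_fg.2 (finite_mulRight_sum hφ.eq_bot F)
  let B : A →ₗ[k] Y →ₗ[k] k := (LinearMap.mul k A).flip.compr₂ φ |>.compl₂ Y.subtype
  have hB : Function.Surjective B := by
    rw [← LinearMap.flip_injective_iff₂]
    refine (injective_iff_map_eq_zero _).2 fun y hy => Subtype.ext (hφ.nondeg_left _ fun z => ?_)
    exact LinearMap.congr_fun hy z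
  obtain ⟨a, ha⟩ := hB (f ∘ₗ Y.subtype)
  refine ⟨(∑ j ∈ F, e j) * a, fun z => ?_⟩
  have h1 : φ ((z * ∑ i ∈ F, e i) * a) = f (z * ∑ i ∈ F, e i) :=
    LinearMap.congr_fun ha ⟨_, z, rfl⟩
  rw [← mul_assoc, h1, (hF z).2]

theorem comp_mulLeft_mem (a : A) : φ ∘ₗ LinearMap.mulLeft k a ∈ localDual 𝒜 e := by
  classical
  obtain ⟨G, hG⟩ := mul_unit_eq_zero 𝒜 e a
  refine ⟨n + 1, G ∪ G.map τ.toEmbedding, fun t ht x hx => ?_, fun j hj x => ?_⟩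
  · rw [hφ.eq_zero_of_lt t ht hx, map_zero]
  · rw [Finset.mem_union, not_or, Finset.mem_map_equiv] at hj
    have := hφ.swap (τ.symm j) (a * x)
    rw [Equiv.apply_symm_apply] at this
    simp only [LinearMap.comp_apply, LinearMap.mulLeft_apply]
    rw [← mul_assoc, (hG j hj.1).2, ← mul_assoc, this, ← mul_assoc, (hG _ hj.2).1]
    simp

theorem comp_mulRight_mem (a : A) : φ ∘ₗ LinearMap.mulRight k a ∈ localDual 𝒜 e := by
  classical
  obtain ⟨G, hG⟩ := mul_unit_eq_zero 𝒜 e a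
  refine ⟨n + 1, G ∪ G.map τ.symm.toEmbedding, fun t ht x hx => ?_, fun j hj x => ?_⟩
  · rw [hφ.eq_zero_of_lt t ht hx, map_zero]
  · rw [Finset.mem_union, not_or, Finset.mem_map_equiv, Equiv.symm_symm] at hj
    simp only [LinearMap.comp_apply, LinearMap.mulRight_apply]
    rw [mul_assoc, ← hφ.swap, mul_assoc, (hG _ hj.2).2, mul_assoc, (hG j hj.1).1]
    simp

/-- The degree of `a` can be read off from the form `φ(a ·)`. -/
theorem mem_iff (a : A) (t : ℕ) :
    a ∈ 𝒜 t ↔ ∀ s, s + t ≠ n + 1 → ∀ z ∈ 𝒜 s, φ (a * z) = 0 := by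
  refine ⟨fun ha s hs z hz => hφ.eq_zero _ (by omega) _ (h.mul_mem ha hz), fun ha => ?_⟩
  refine mem_of_homProj_eq_zero (e := e) fun u hu => hφ.nondeg_left _ fun z => ?_
  induction z using homogeneous_induction 𝒜 e with
  | mem s z hz =>
    by_cases hs : s + u = n + 1
    · rw [← homProj_mul_right (e := e) hz, add_comm, hs,
        apply_homProj_of_eq_zero (e := e) hφ.eq_zero, ha s (by omega) z hz]
    · exact hφ.eq_zero _ (by omega) _ (h.mul_mem (homProj_mem u a) hz)
  | zero => simp
  | add x y hx hy => rw [mul_add, map_add, hx, hy, add_zero]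

theorem mem_iff' (a : A) (t : ℕ) :
    a ∈ 𝒜 t ↔ ∀ s, s + t ≠ n + 1 → ∀ z ∈ 𝒜 s, φ (z * a) = 0 := by
  refine ⟨fun ha s hs z hz => hφ.eq_zero _ (by omega) _ (h.mul_mem hz ha), fun ha => ?_⟩
  refine mem_of_homProj_eq_zero (e := e) fun u hu => hφ.nondeg_right _ fun z => ?_
  induction z using homogeneous_induction 𝒜 e with
  | mem s z hz =>
    by_cases hs : s + u = n + 1
    · rw [← homProj_mul_left (e := e) hz, hs, apply_homProj_of_eq_zero (e := e) hφ.eq_zero,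
        ha s (by omega) z hz]
    · exact hφ.eq_zero _ (by omega) _ (h.mul_mem hz (homProj_mem u a))
  | zero => simp
  | add x y hx hy => rw [add_mul, map_add, hx, hy, add_zero]

end IsFrobeniusForm

/-- An isomorphism `r` of graded bimodules between `D_* Λ` and `Λ`, where the left action on `Λ` is
twisted by an automorphism `ν` of the graded algebra `Λ` (a Nakayama automorphism). The forms
on `Λ_s` correspond to the elements of `Λ_{n+1-s}`, and `Λ_t = 0` for `t > n + 1`. -/
structure NakayamaIso (𝒜 : ℕ → Submodule k A) (e : V → A) [IsLocFinGraded 𝒜 e] (n : ℕ) where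
  eq_bot : ∀ t, n + 1 < t → 𝒜 t = ⊥
  ν : A ≃ₗ[k] A
  ν_mul : ∀ a b, ν (a * b) = ν a * ν b
  ν_mem : ∀ (t : ℕ) (a : A), ν a ∈ 𝒜 t ↔ a ∈ 𝒜 t
  r : localDual 𝒜 e ≃ₗ[k] A
  r_left : ∀ (a : A) (f : localDual 𝒜 e), r (leftAct a f) = ν a * r f
  r_right : ∀ (f : localDual 𝒜 e) (a : A), r (rightAct f a) = r f * a
  r_mem : ∀ (t : ℕ) (f : localDual 𝒜 e),
    r f ∈ 𝒜 t ↔ ∀ s, s + t ≠ n + 1 → ∀ z ∈ 𝒜 s, f.1 z = 0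

/-- With a Frobenius form `φ`, the form `φ(a ·)` corresponds to `a`, and `φ(ν(a) z) = φ(z a)`. -/
theorem IsFrobeniusForm.nonempty_nakayamaIso {n : ℕ} {τ : V ≃ V} {φ : A →ₗ[k] k}
    (hφ : IsFrobeniusForm 𝒜 e n τ φ) : Nonempty (NakayamaIso 𝒜 e n) := by
  let L : A →ₗ[k] localDual 𝒜 e := LinearMap.codRestrict _ ((LinearMap.mul k A).compr₂ φ)
    hφ.comp_mulLeft_mem
  let R : A →ₗ[k] localDual 𝒜 e := LinearMap.codRestrict _ ((LinearMap.mul k A).flip.compr₂ φ)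
    hφ.comp_mulRight_mem
  have hL : ∀ a z, (L a).1 z = φ (a * z) := fun _ _ => rfl
  have hR : ∀ a z, (R a).1 z = φ (z * a) := fun _ _ => rfl
  have hLb : Function.Bijective L := by
    refine ⟨(injective_iff_map_eq_zero _).2 fun a ha => hφ.nondeg_left a fun z => ?_, fun f => ?_⟩
    · rw [← hL, ha]; rfl
    · obtain ⟨a, ha⟩ := hφ.exists_eq_apply_mul f.2
      exact ⟨a, Subtype.ext (LinearMap.ext ha)⟩
  have hRb : Function.Bijective R := by
    refine ⟨(injective_iff_map_eq_zero _).2 fun a ha => hφ.nondeg_right a fun z => ?_, fun f => ?_⟩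
    · rw [← hR, ha]; rfl
    · obtain ⟨a, ha⟩ := hφ.exists_eq_apply_mul' f.2
      exact ⟨a, Subtype.ext (LinearMap.ext ha)⟩
  let r := (LinearEquiv.ofBijective L hLb).symm
  let ν := (LinearEquiv.ofBijective R hRb).trans r
  have hr : ∀ f z, φ (r f * z) = f.1 z := fun f z => by
    rw [← hL]
    exact congrArg (fun g : localDual 𝒜 e => g.1 z)
      (LinearEquiv.apply_symm_apply (LinearEquiv.ofBijective L hLb) f)
  have hν : ∀ a z, φ (ν a * z) = φ (z * a) := fun a z => hr (R a) z
  have hext : ∀ a b, (∀ z, φ (a * z) = φ (b * z)) → a = b := fun a b hab =>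
    sub_eq_zero.1 (hφ.nondeg_left _ fun z => by rw [sub_mul, map_sub, hab, sub_self])
  refine ⟨⟨hφ.eq_bot, ν, fun a b => hext _ _ fun z => ?_, fun t a => ?_, r,
    fun a f => hext _ _ fun z => ?_, fun f a => hext _ _ fun z => ?_, fun t f => ?_⟩⟩
  · rw [hν, mul_assoc (ν a), hν, mul_assoc, hν, mul_assoc]
  · rw [hφ.mem_iff, hφ.mem_iff']
    simp only [hν]
  · rw [hr, mul_assoc, hν, mul_assoc, hr]
    rfl
  · rw [hr, mul_assoc, hr]
    rfl
  · rw [hφ.mem_iff]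
    simp only [hr]

end FrobeniusForm

/-! ### The grading of the trivial extension -/

section TrivialExtensionGraded

variable {k A V : Type u} [Field k] [NonUnitalRing A] [Module k A]
  [IsScalarTower k A A] [SMulCommClass k A A]
  {𝒜 : ℕ → Submodule k A} {e : V → A} [h : IsLocFinGraded 𝒜 e] {n : ℕ}

namespace TrivExt

variable (𝒜 e) in
/-- The inclusion of `Λ` into the trivial extension. -/
def inl : A →ₗ[k] TrivExt 𝒜 e := LinearMap.inl k A (localDual 𝒜 e)

variable (𝒜 e) in
/-- The inclusion of `D_* Λ` into the trivial extension. -/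
def inr : localDual 𝒜 e →ₗ[k] TrivExt 𝒜 e := LinearMap.inr k A (localDual 𝒜 e)

variable (𝒜 e) in
/-- The projection of the trivial extension onto `Λ`. -/
def fstₗ : TrivExt 𝒜 e →ₗ[k] A := LinearMap.fst k A (localDual 𝒜 e)

variable (𝒜 e) in
/-- The projection of the trivial extension onto `D_* Λ`. -/
def sndₗ : TrivExt 𝒜 e →ₗ[k] localDual 𝒜 e := LinearMap.snd k A (localDual 𝒜 e)

theorem inl_fst (a : A) : (inl 𝒜 e a).1 = a := rfl

theorem inl_snd (a : A) : (inl 𝒜 e a).2 = 0 := rfl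

theorem inr_fst (f : localDual 𝒜 e) : (inr 𝒜 e f).1 = 0 := rfl

theorem inr_snd (f : localDual 𝒜 e) : (inr 𝒜 e f).2 = f := rfl

theorem idem_eq_inl (i : V) : idem 𝒜 e i = inl 𝒜 e (e i) := rfl

theorem eq_inl_add_inr (x : TrivExt 𝒜 e) : x = inl 𝒜 e x.1 + inr 𝒜 e x.2 :=
  Prod.ext (add_zero _).symm (zero_add _).symm

theorem inl_mul_inl (a b : A) : inl 𝒜 e a * inl 𝒜 e b = inl 𝒜 e (a * b) :=
  ext' rfl fun z => by
    rw [mul_snd, inl_snd, inl_snd, inl_snd]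
    exact add_zero _

theorem inl_mul_inr (a : A) (f : localDual 𝒜 e) :
    inl 𝒜 e a * inr 𝒜 e f = inr 𝒜 e (leftAct a f) :=
  ext' (mul_zero a) fun z => by
    rw [mul_snd, inl_snd, inr_snd, inl_fst]
    exact add_zero _

theorem inr_mul_inl (f : localDual 𝒜 e) (a : A) :
    inr 𝒜 e f * inl 𝒜 e a = inr 𝒜 e (rightAct f a) :=
  ext' (zero_mul a) fun z => by
    rw [mul_snd, inl_snd, inr_snd, inl_fst]
    exact zero_add _

theorem inr_mul_inr (f g : localDual 𝒜 e) : inr 𝒜 e f * inr 𝒜 e g = 0 :=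
  ext' (zero_mul 0) fun z => by
    rw [mul_snd, inr_snd, inr_snd, inr_fst, inr_fst, mul_zero, zero_mul, map_zero, map_zero]
    exact add_zero _

theorem inl_mem_grading {a : A} {t : ℕ} (ha : a ∈ 𝒜 t) : inl 𝒜 e a ∈ grading 𝒜 e n t :=
  ⟨ha, fun _ _ _ _ => rfl⟩

theorem inr_mem_grading {f : localDual 𝒜 e} {t : ℕ}
    (hf : ∀ s : ℕ, s + t ≠ n + 2 → ∀ z ∈ 𝒜 s, f.1 z = 0) : inr 𝒜 e f ∈ grading 𝒜 e n t :=
  ⟨zero_mem _, hf⟩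

theorem snd_eq_zero {f : localDual 𝒜 e} (hf : ∀ s, ∀ z ∈ 𝒜 s, f.1 z = 0) : f = 0 :=
  Subtype.ext (LinearMap.ext fun z => by
    induction z using homogeneous_induction 𝒜 e with
    | mem s z hz => exact hf s z hz
    | zero => simp
    | add x y hx hy => rw [map_add, map_add, hx, hy])

theorem snd_eq_zero_of_mem_zero (hN : ∀ t, n + 1 < t → 𝒜 t = ⊥) {x : TrivExt 𝒜 e}
    (hx : x ∈ grading 𝒜 e n 0) : x.2 = 0 := by
  refine snd_eq_zero fun s z hz => ?_
  by_cases hs : s = n + 2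
  · rw [hN s (by omega), Submodule.mem_bot] at hz
    rw [hz, map_zero]
  · exact hx.2 s (by omega) z hz

theorem grading_eq_bot (hN : ∀ t, n + 1 < t → 𝒜 t = ⊥) (t : ℕ) (ht : n + 2 < t) :
    grading 𝒜 e n t = ⊥ := by
  refine eq_bot_iff.2 fun x hx => ?_
  have h1 := hx.1
  rw [hN t (by omega), Submodule.mem_bot] at h1
  exact ext' h1 fun z => by
    rw [snd_eq_zero fun s z hz => hx.2 s (by omega) z hz]
    rfl

theorem mul_mem_grading {s t : ℕ} {x y : TrivExt 𝒜 e} (hx : x ∈ grading 𝒜 e n s)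
    (hy : y ∈ grading 𝒜 e n t) : x * y ∈ grading 𝒜 e n (s + t) := by
  refine ⟨h.mul_mem hx.1 hy.1, fun u hu z hz => ?_⟩
  rw [mul_snd, hy.2 (u + s) (by omega) _ (h.mul_mem hz hx.1),
    hx.2 (t + u) (by omega) _ (h.mul_mem hy.1 hz), add_zero]

theorem iSupIndep_grading : iSupIndep (grading 𝒜 e n) := by
  rw [iSupIndep_iff_finsetSum_eq_zero_imp_eq_zero]
  intro F v hv hsum t ht
  have hfst : ∑ i ∈ F, (v i).1 = 0 := by
    have := congrArg (fstₗ 𝒜 e) hsum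
    rw [map_sum, map_zero] at this
    exact this
  have hsnd : ∀ z, ∑ i ∈ F, (v i).2.1 z = 0 := fun z => by
    have := congrArg (((LinearMap.applyₗ z).comp (localDual 𝒜 e).subtype).comp (sndₗ 𝒜 e)) hsum
    rw [map_sum, map_zero] at this
    exact this
  refine ext' ?_ fun z => ?_
  · exact (iSupIndep_iff_finsetSum_eq_zero_imp_eq_zero 𝒜).1 (NTrans.iSupIndep_grading 𝒜 e) F
      (fun i => (v i).1) (fun i hi => (hv i hi).1) hfst t ht
  · have : (v t).2 = 0 := by
      refine snd_eq_zero fun s z hz => ?_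
      -- On `Λ_s` only the summand of degree `n + 2 - s` can be nonzero.
      by_cases hs : s + t = n + 2
      · rw [← hsnd z, Finset.sum_eq_single_of_mem t ht]
        intro u hu hut
        exact (hv u hu).2 s (by omega) z hz
      · exact (hv t ht).2 s hs z hz
    rw [this]
    rfl

end TrivExt

namespace NakayamaIso

open TrivExt

variable (N : NakayamaIso 𝒜 e n)

theorem inr_symm_mem_grading {a : A} {t : ℕ} (ha : a ∈ 𝒜 t) :
    inr 𝒜 e (N.r.symm a) ∈ grading 𝒜 e n (t + 1) := by
  rw [← N.r.apply_symm_apply a, N.r_mem] at ha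
  exact inr_mem_grading fun s hs => ha s (by omega)

theorem r_mem_of_mem_grading {x : TrivExt 𝒜 e} {t : ℕ} (hx : x ∈ grading 𝒜 e n (t + 1)) :
    N.r x.2 ∈ 𝒜 t :=
  (N.r_mem t x.2).2 fun s hs => hx.2 s (by omega)

theorem symm_mul (a b : A) : N.r.symm (a * b) = rightAct (N.r.symm a) b := by
  rw [LinearEquiv.symm_apply_eq, N.r_right, LinearEquiv.apply_symm_apply]

theorem symm_ν_mul (a b : A) : N.r.symm (N.ν a * b) = leftAct a (N.r.symm b) := by
  rw [LinearEquiv.symm_apply_eq, N.r_left, LinearEquiv.apply_symm_apply]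

include N

/-- `Λ ⋉ D_* Λ` is generated in degrees `0` and `1` because `D_* Λ` is generated, as a right
`Λ`-module, by the forms which correspond to the idempotents, and these have degree `1`. -/
theorem isLocFinGraded_trivExt : IsLocFinGraded (grading 𝒜 e n) (idem 𝒜 e) where
  isInternal := by
    rw [DirectSum.isInternal_submodule_iff_iSupIndep_and_iSup_eq_top]
    refine ⟨TrivExt.iSupIndep_grading, eq_top_iff.2 fun x _ => ?_⟩
    rw [eq_inl_add_inr x, ← N.r.symm_apply_apply x.2]
    refine add_mem ?_ ?_
    · induction x.1 using homogeneous_induction 𝒜 e with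
      | mem t a ha => exact Submodule.mem_iSup_of_mem t (inl_mem_grading ha)
      | zero => simp
      | add a b ha hb => rw [map_add]; exact add_mem ha hb
    · induction N.r x.2 using homogeneous_induction 𝒜 e with
      | mem t a ha => exact Submodule.mem_iSup_of_mem (t + 1) (N.inr_symm_mem_grading ha)
      | zero => simp
      | add a b ha hb => rw [map_add, map_add]; exact add_mem ha hb
  mul_mem := mul_mem_grading
  idem i := by rw [idem_eq_inl, inl_mul_inl, h.idem]
  orth i j hij := by rw [idem_eq_inl, idem_eq_inl, inl_mul_inl, h.orth i j hij, map_zero]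
  linearIndependent := LinearIndependent.of_comp (fstₗ 𝒜 e) h.linearIndependent
  span_zero := by
    have h1 : Set.range (idem 𝒜 e) = inl 𝒜 e '' Set.range e := by
      rw [← Set.range_comp]
      rfl
    rw [h1, ← Submodule.map_span, h.span_zero]
    refine le_antisymm ?_ fun x hx => ?_
    · rintro _ ⟨a, ha, rfl⟩
      exact inl_mem_grading ha
    · rw [eq_inl_add_inr x, snd_eq_zero_of_mem_zero N.eq_bot hx, map_zero, add_zero]
      exact ⟨x.1, hx.1, rfl⟩
  local_unit x := by
    classical
    obtain ⟨F, h1, h2⟩ := h.local_unit x.1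
    obtain ⟨G, hG⟩ := exists_sum_idem_of_mem_localDual x.2.2
    have hG' : ∀ z, x.2.1 ((∑ i ∈ F ∪ G, e i) * z) = x.2.1 z ∧
        x.2.1 (z * ∑ i ∈ F ∪ G, e i) = x.2.1 z := by
      intro z
      constructor
      · rw [← (hG _).1, ← mul_assoc, sum_idem_mul_sum_idem' 𝒜 Finset.subset_union_right, (hG z).1]
      · rw [← (hG _).2, mul_assoc, sum_idem_mul_sum_idem 𝒜 Finset.subset_union_right, (hG z).2]
    have hsum : ∑ i ∈ F ∪ G, idem 𝒜 e i = inl 𝒜 e (∑ i ∈ F ∪ G, e i) :=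
      (map_sum (inl 𝒜 e) e _).symm
    refine ⟨F ∪ G, ?_, ?_⟩
    · rw [hsum]
      refine ext' (sum_idem_mul_of_subset 𝒜 Finset.subset_union_left h1) fun z => ?_
      rw [mul_snd, inl_fst, (hG' z).2, inl_snd]
      exact add_zero _
    · rw [hsum]
      refine ext' (mul_sum_idem_of_subset 𝒜 Finset.subset_union_left h2) fun z => ?_
      rw [mul_snd, inl_fst, (hG' z).1, inl_snd]
      exact zero_add _
  generated t := by
    refine le_antisymm (fun x hx => ?_) (Submodule.span_le.2 ?_)
    · rw [eq_inl_add_inr x]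
      refine add_mem ?_ (Submodule.subset_span ?_)
      · have h1 := hx.1
        rw [h.generated] at h1
        have h2 := Submodule.mem_map_of_mem (f := inl 𝒜 e) h1
        rw [Submodule.map_span] at h2
        refine Submodule.span_mono ?_ h2
        rintro _ ⟨_, ⟨a, ha, b, hb, rfl⟩, rfl⟩
        exact ⟨_, inl_mem_grading ha, _, inl_mem_grading hb, (inl_mul_inl a b).symm⟩
      · obtain ⟨F, hF, -⟩ := h.local_unit (N.r x.2)
        -- With `b = r f` and `b = e_F b`, the form `f` is the product of `φ e_F` and `b`.
        refine ⟨_, N.inr_symm_mem_grading (sum_idem_mem (e := e) F), _,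
          inl_mem_grading (N.r_mem_of_mem_grading hx), ?_⟩
        rw [inr_mul_inl, ← N.symm_mul, hF, LinearEquiv.symm_apply_apply]
    · rintro _ ⟨a, ha, b, hb, rfl⟩
      rw [add_comm]
      exact mul_mem_grading ha hb
  finite_out i := by
    refine Submodule.FG.of_le (((h.finite_out i).map (inl 𝒜 e)).sup
      ((Submodule.fg_span_singleton (R := k) (e i)).map
        ((inr 𝒜 e).comp N.r.symm.toLinearMap))) (Submodule.span_le.2 ?_)
    rintro _ ⟨x, hx, rfl⟩
    have h1 : x * idem 𝒜 e i = inl 𝒜 e (x.1 * e i) + inr 𝒜 e (rightAct x.2 (e i)) := by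
      conv_lhs => rw [eq_inl_add_inr x]
      rw [add_mul, idem_eq_inl, inl_mul_inl, inr_mul_inl]
    rw [h1]
    refine Submodule.add_mem_sup ⟨_, Submodule.subset_span ⟨_, hx.1, rfl⟩, rfl⟩
      ⟨N.r x.2 * e i, (mul_idem_mem_span (N.r_mem_of_mem_grading hx) i).1, ?_⟩
    simp [N.symm_mul]
  finite_in i := by
    classical
    obtain ⟨F, hF, -⟩ := h.local_unit (N.ν (e i))
    have hfin : (Submodule.span k (e '' (F : Set V))).FG :=
      Submodule.fg_span (F.finite_toSet.image e)
    refine Submodule.FG.of_le (((h.finite_in i).map (inl 𝒜 e)).sup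
      (hfin.map ((inr 𝒜 e).comp N.r.symm.toLinearMap))) (Submodule.span_le.2 ?_)
    rintro _ ⟨x, hx, rfl⟩
    have h1 : idem 𝒜 e i * x = inl 𝒜 e (e i * x.1) + inr 𝒜 e (leftAct (e i) x.2) := by
      conv_lhs => rw [eq_inl_add_inr x]
      rw [mul_add, idem_eq_inl, inl_mul_inl, inl_mul_inr]
    rw [h1]
    refine Submodule.add_mem_sup ⟨_, Submodule.subset_span ⟨_, hx.1, rfl⟩, rfl⟩
      ⟨N.ν (e i) * N.r x.2, ?_, ?_⟩
    · have h2 : N.ν (e i) * N.r x.2 ∈ 𝒜 0 :=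
        h.mul_mem ((N.ν_mem 0 _).2 (idem_mem (e := e) i)) (N.r_mem_of_mem_grading hx)
      rw [SetLike.mem_coe, ← hF, mul_assoc, Finset.sum_mul]
      refine Submodule.sum_mem _ fun j hj => ?_
      refine Submodule.span_mono ?_ (mul_idem_mem_span h2 j).2
      rintro _ rfl
      exact ⟨j, hj, rfl⟩
    · simp [N.symm_ν_mul]

end NakayamaIso

end TrivialExtensionGraded

/-! ### The bound quiver of the trivial extension -/

section SymmetricQuiver

variable {k A V : Type u} [Field k] [NonUnitalRing A] [Module k A]
  [IsScalarTower k A A] [SMulCommClass k A A]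
  {𝒜 : ℕ → Submodule k A} {e : V → A} [h : IsLocFinGraded 𝒜 e] {n : ℕ}

/-- If every nonzero element of `e_j Λ_t e_i` can be multiplied from both sides by elements of
`e_i Λ_{n+1-t} e_j` to nonzero elements, then every bound path is part of a bound path of length
`n + 1`, and the bound quiver of `Λ` is an `n`-translation quiver with the identity as its
translation. -/
theorem ArrowSystem.isNTranslationQuiver_refl (Q : ArrowSystem 𝒜 e)
    (hnd : ∀ (i j : V) (t : ℕ) (x : A), x ∈ piece 𝒜 e t i j → x ≠ 0 → ∃ s, s + t = n + 1 ∧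
      (∃ y ∈ piece 𝒜 e s j i, x * y ≠ 0) ∧ ∃ y ∈ piece 𝒜 e s j i, y * x ≠ 0)
    (hdim : ∀ (i : V) (x y : A), x ∈ piece 𝒜 e (n + 1) i i → y ∈ piece 𝒜 e (n + 1) i i →
      ¬ LinearIndependent k ![x, y]) :
    Q.IsNTranslationQuiver n ∅ ∅ (Equiv.refl _) := by
  have hright : ∀ (i j : V) (t : ℕ) (x : A), x ∈ piece 𝒜 e t i j → x ≠ 0 →
      ∃ q : Q.Path j i, Q.len q + t = n + 1 ∧ x * Q.eval q ≠ 0 := by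
    intro i j t x hx hx0
    obtain ⟨s, hs, ⟨y, hy, hxy⟩, -⟩ := hnd i j t x hx hx0
    obtain ⟨q, hq, hq'⟩ := Q.exists_path_ne_zero hy (LinearMap.mulLeft k x) hxy
    exact ⟨q, by omega, hq'⟩
  have hleft : ∀ (i j : V) (t : ℕ) (x : A), x ∈ piece 𝒜 e t i j → x ≠ 0 →
      ∃ q : Q.Path j i, Q.len q + t = n + 1 ∧ Q.eval q * x ≠ 0 := by
    intro i j t x hx hx0
    obtain ⟨s, hs, -, y, hy, hxy⟩ := hnd i j t x hx hx0
    obtain ⟨q, hq, hq'⟩ := Q.exists_path_ne_zero hy (LinearMap.mulRight k x) hxy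
    exact ⟨q, by omega, hq'⟩
  refine ⟨fun i => ?_, fun j i p hp => ?_, fun i p q hp hq _ _ => ?_, fun i j t X _ hX hX0 => ?_,
    fun i j t X _ hX hX0 => ?_⟩
  · obtain ⟨q, hq, hq'⟩ := hright i i 0 (e i) (idem_mem_piece _) (idem_ne_zero 𝒜 _)
    exact ⟨q, hq, right_ne_zero_of_mul hq'⟩
  · obtain ⟨q, hq, hq'⟩ := hright j i _ _ (Q.eval_mem_piece p) hp.1
    have hlen := (hp.2 i i q (Q.nil i) (by
      change Q.eval (Q.concat q p) ≠ 0
      rwa [Q.eval_concat])).1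
    refine ⟨by omega, Set.notMem_empty i, Q.eq_of_len_eq_zero q hlen⟩
  · refine hdim i _ _ ?_ ?_
    · rw [← hp]; exact Q.eval_mem_piece p
    · rw [← hq]; exact Q.eval_mem_piece q
  · exact hright j i t _ (Q.evalLin_mem_piece X hX) hX0
  · exact hleft i j t _ (Q.evalLin_mem_piece X hX) hX0

namespace TrivExt

theorem fst_mem_piece {t : ℕ} {i j : V} {x : TrivExt 𝒜 e}
    (hx : x ∈ piece (grading 𝒜 e n) (idem 𝒜 e) t i j) : x.1 ∈ piece 𝒜 e t i j :=
  ⟨hx.1.1, congrArg Prod.fst hx.2.1, congrArg Prod.fst hx.2.2⟩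

theorem snd_sandwich {t : ℕ} {i j : V} {x : TrivExt 𝒜 e}
    (hx : x ∈ piece (grading 𝒜 e n) (idem 𝒜 e) t i j) (z : A) :
    x.2.1 (e i * z * e j) = x.2.1 z := by
  have h1 : (idem 𝒜 e j * x * idem 𝒜 e i).2.1 z = x.2.1 (e i * z * e j) := by
    rw [mul_snd, mul_snd, idem_eq_inl, idem_eq_inl, inl_snd, inl_snd, inl_fst, inl_fst]
    exact (zero_add _).trans (add_zero _)
  rw [← h1, hx.2.1, hx.2.2]

/-- The symmetric pairing between `Λ` and `D_* Λ` in the trivial extension is nondegenerate. -/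
theorem exists_mul_ne_zero (hN : ∀ t, n + 1 < t → 𝒜 t = ⊥) (i j : V) (t : ℕ) (x : TrivExt 𝒜 e)
    (hx : x ∈ piece (grading 𝒜 e n) (idem 𝒜 e) t i j) (hx0 : x ≠ 0) :
    ∃ s, s + t = n + 1 + 1 ∧
      (∃ y ∈ piece (grading 𝒜 e n) (idem 𝒜 e) s j i, x * y ≠ 0) ∧
      ∃ y ∈ piece (grading 𝒜 e n) (idem 𝒜 e) s j i, y * x ≠ 0 := by
  classical
  -- If `x = (a, 0)`, then multiply by a form on `e_j Λ_t e_i` which is nonzero at `a`; if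
  -- `x = (a, f)` with `f ≠ 0`, then multiply by an element at which `f` is nonzero.
  by_cases hx2 : x.2 = 0
  · have ha := fst_mem_piece hx
    have ha0 : x.1 ≠ 0 := fun h1 => hx0 (Prod.ext h1 hx2)
    set a := x.1 with ha'
    have ht : t ≤ n + 1 := by
      by_contra! hc
      have := ha.1
      rw [hN t hc, Submodule.mem_bot] at this
      exact ha0 this
    obtain ⟨ψ, hψ⟩ : ∃ ψ : Module.Dual k A, ψ a ≠ 0 := by
      by_contra! hc
      exact ha0 ((Module.forall_dual_apply_eq_zero_iff k a).1 hc)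
    let g : Module.Dual k A :=
      ψ ∘ₗ LinearMap.mulLeft k (e j) ∘ₗ LinearMap.mulRight k (e i) ∘ₗ homProj 𝒜 e t
    have hg : ∀ w, g w = ψ (e j * (homProj 𝒜 e t w * e i)) := fun _ => rfl
    have hl : ∀ l w, homProj 𝒜 e t (e l * w) = e l * homProj 𝒜 e t w := fun l w => by
      have := homProj_mul_left (e := e) (idem_mem (𝒜 := 𝒜) (e := e) l) t w
      rwa [zero_add] at this
    have hr : ∀ l w, homProj 𝒜 e t (w * e l) = homProj 𝒜 e t w * e l := fun l w => by
      have := homProj_mul_right (e := e) (idem_mem (𝒜 := 𝒜) (e := e) l) t w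
      rwa [add_zero] at this
    have hg0 : ∀ s, s ≠ t → ∀ z ∈ 𝒜 s, g z = 0 := fun s hs z hz => by
      rw [hg, homProj_of_mem_of_ne hs hz, zero_mul, mul_zero, map_zero]
    have hgmem : g ∈ localDual 𝒜 e := by
      refine ⟨t, {i, j}, fun s hs z hz => hg0 s (by omega) z hz, fun l hl' w => ?_⟩
      simp only [Finset.mem_insert, Finset.mem_singleton, not_or] at hl'
      constructor
      · rw [hg, hl, mul_assoc, ← mul_assoc, h.orth j l (Ne.symm hl'.2), zero_mul, map_zero]
      · rw [hg, hr, mul_assoc, h.orth l i hl'.1, mul_zero, mul_zero, map_zero]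
    have hga : g a ≠ 0 := by
      rw [hg, homProj_of_mem ha.1, ha.2.2, ha.2.1]
      exact hψ
    let y : TrivExt 𝒜 e := inr 𝒜 e ⟨g, hgmem⟩
    have hy : y ∈ piece (grading 𝒜 e n) (idem 𝒜 e) (n + 2 - t) j i := by
      refine ⟨inr_mem_grading fun s hs z hz => hg0 s (by omega) z hz, ?_, ?_⟩
      · rw [idem_eq_inl, inl_mul_inr]
        refine congrArg (inr 𝒜 e) (Subtype.ext (LinearMap.ext fun w => ?_))
        change g (w * e i) = g w
        rw [hg, hr, mul_assoc, h.idem, hg]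
      · rw [idem_eq_inl, inr_mul_inl]
        refine congrArg (inr 𝒜 e) (Subtype.ext (LinearMap.ext fun w => ?_))
        change g (e j * w) = g w
        rw [hg, hl, mul_assoc, ← mul_assoc, h.idem, hg]
    refine ⟨n + 2 - t, by omega, ⟨y, hy, fun h0 => hga ?_⟩, ⟨y, hy, fun h0 => hga ?_⟩⟩
    · have h1 := mul_snd x y (e j)
      rw [h0, hx2, ← ha', ha.2.1] at h1
      exact (h1.trans (add_zero _)).symm
    · have h1 := mul_snd y x (e i)
      rw [h0, hx2, ← ha', ha.2.2] at h1
      exact (h1.trans (zero_add _)).symm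
  · obtain ⟨s, z, hz, hxz⟩ : ∃ s, ∃ z ∈ 𝒜 s, x.2.1 z ≠ 0 := by
      by_contra! hc
      exact hx2 (snd_eq_zero hc)
    have hs : s + t = n + 2 := by
      by_contra hc
      exact hxz (hx.1.2 s hc z hz)
    rw [← snd_sandwich hx] at hxz
    have hz' := sandwich_mem_piece (e := e) hz j i
    set z' := e i * z * e j
    have hy : inl 𝒜 e z' ∈ piece (grading 𝒜 e n) (idem 𝒜 e) s j i := by
      refine ⟨inl_mem_grading hz'.1, ?_, ?_⟩
      · rw [idem_eq_inl, inl_mul_inl, hz'.2.1]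
      · rw [idem_eq_inl, inl_mul_inl, hz'.2.2]
    refine ⟨s, hs, ⟨_, hy, fun h0 => hxz ?_⟩, ⟨_, hy, fun h0 => hxz ?_⟩⟩
    · have h1 := mul_snd x (inl 𝒜 e z') (e j)
      rw [h0, inl_snd, inl_fst, hz'.2.2] at h1
      exact (h1.trans (zero_add _)).symm
    · have h1 := mul_snd (inl 𝒜 e z') x (e i)
      rw [h0, inl_snd, inl_fst, hz'.2.1] at h1
      exact (h1.trans (add_zero _)).symm

/-- `e_i (Λ ⋉ D_* Λ)_{n+2} e_i` consists of the forms on the one-dimensional space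
`e_i Λ₀ e_i`. -/
theorem not_linearIndependent_top (hN : ∀ t, n + 1 < t → 𝒜 t = ⊥) (i : V) (x y : TrivExt 𝒜 e)
    (hx : x ∈ piece (grading 𝒜 e n) (idem 𝒜 e) (n + 1 + 1) i i)
    (hy : y ∈ piece (grading 𝒜 e n) (idem 𝒜 e) (n + 1 + 1) i i) :
    ¬ LinearIndependent k ![x, y] := by
  have key : ∀ x ∈ piece (grading 𝒜 e n) (idem 𝒜 e) (n + 1 + 1) i i, x.2.1 (e i) = 0 →
      x = 0 := by
    intro x hx h0
    have h1 := hx.1.1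
    rw [hN _ (by omega), Submodule.mem_bot] at h1
    refine Prod.ext h1 (snd_eq_zero fun s z hz => ?_)
    by_cases hs : s = 0
    · subst hs
      obtain ⟨c, hc, -⟩ := exists_smul_of_mem_zero (e := e) hz i i
      rw [← snd_sandwich hx, hc, map_smul, h0, smul_zero]
    · exact hx.1.2 s (by omega) z hz
  intro hli
  have h1 : y.2.1 (e i) • x + (-(x.2.1 (e i))) • y = 0 :=
    key _ (add_mem (Submodule.smul_mem _ _ hx) (Submodule.smul_mem _ _ hy)) (by
      rw [add_snd, smul_snd, smul_snd, smul_eq_mul, smul_eq_mul]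
      ring)
  have h2 := (LinearIndependent.pair_iff.1 hli _ _ h1).2
  have h3 : x ≠ 0 := hli.ne_zero 0
  exact h3 (key x hx (neg_eq_zero.1 h2))

end TrivExt

end SymmetricQuiver

/-! ### Graded modules -/

section GradedModules

theorem isInternal_sub {k M : Type*} [Ring k] [AddCommGroup M] [Module k M]
    {p : ℤ → Submodule k M} (hp : DirectSum.IsInternal p) (c : ℤ) :
    DirectSum.IsInternal fun t => p (t - c) := by
  rw [DirectSum.isInternal_submodule_iff_iSupIndep_and_iSup_eq_top] at hp ⊢
  refine ⟨hp.1.comp (sub_left_injective (b := c)), ?_⟩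
  rw [← hp.2]
  exact (Equiv.subRight c).iSup_comp (g := p)

theorem isInternal_prod {k M N : Type*} [Ring k] [AddCommGroup M] [Module k M]
    [AddCommGroup N] [Module k N] {p : ℤ → Submodule k M} {q : ℤ → Submodule k N}
    (hp : DirectSum.IsInternal p) (hq : DirectSum.IsInternal q) :
    DirectSum.IsInternal fun t => (p t).prod (q t) := by
  rw [DirectSum.isInternal_submodule_iff_iSupIndep_and_iSup_eq_top] at hp hq ⊢
  refine ⟨?_, ?_⟩
  · rw [iSupIndep_iff_finsetSum_eq_zero_imp_eq_zero] at hp hq ⊢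
    intro F v hv hsum t ht
    have h1 : ∑ i ∈ F, (v i).1 = 0 := by rw [← Prod.fst_sum, hsum]; rfl
    have h2 : ∑ i ∈ F, (v i).2 = 0 := by rw [← Prod.snd_sum, hsum]; rfl
    exact Prod.ext (hp.1 F _ (fun i hi => (hv i hi).1) h1 t ht)
      (hq.1 F _ (fun i hi => (hv i hi).2) h2 t ht)
  · refine eq_top_iff.2 fun x _ => ?_
    have h1 : ∀ y : M, (y, (0 : N)) ∈ ⨆ t, (p t).prod (q t) := by
      intro y
      have hy : y ∈ ⨆ t, p t := by rw [hp.2]; trivial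
      induction hy using Submodule.iSup_induction' with
      | mem t y hy => exact Submodule.mem_iSup_of_mem t ⟨hy, zero_mem _⟩
      | zero => exact zero_mem _
      | add y z _ _ hy hz => simpa using add_mem hy hz
    have h2 : ∀ y : N, ((0 : M), y) ∈ ⨆ t, (p t).prod (q t) := by
      intro y
      have hy : y ∈ ⨆ t, q t := by rw [hq.2]; trivial
      induction hy using Submodule.iSup_induction' with
      | mem t y hy => exact Submodule.mem_iSup_of_mem t ⟨zero_mem _, hy⟩
      | zero => exact zero_mem _
      | add y z _ _ hy hz => simpa using add_mem hy hz
    simpa using add_mem (h1 x.1) (h2 x.2)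

variable {k A V : Type u} [Field k] [NonUnitalRing A] [Module k A] {𝒜 : ℕ → Submodule k A}

theorem LMod.IsUnital.induction {M : LMod k A} (hM : M.IsUnital) {p : M.carrier → Prop}
    (act : ∀ a x, p (M.act a x)) (add : ∀ x y, p x → p y → p (x + y)) (m : M.carrier) : p m := by
  have hm : m ∈ Submodule.span k {m : M.carrier | ∃ (a : A) (x : M.carrier), m = M.act a x} := by
    rw [hM]; trivial
  suffices ∀ c : k, p (c • m) by simpa using this 1
  induction hm using Submodule.span_induction with
  | mem x hx =>
    obtain ⟨a, x, rfl⟩ := hx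
    exact fun c => by rw [← map_smul]; exact act a _
  | zero => exact fun c => by simpa using act 0 0
  | add x y _ _ hx hy => exact fun c => by rw [smul_add]; exact add _ _ (hx c) (hy c)
  | smul d x _ hx => exact fun c => by rw [smul_smul]; exact hx _

theorem GrMod.IsGeneratedIn.induction {M : GrMod 𝒜} {t : ℤ} (hM : M.IsGeneratedIn t)
    {p : M.carrier → Prop} (act : ∀ a, ∀ x ∈ M.deg t, p (M.act a x))
    (add : ∀ x y, p x → p y → p (x + y)) (m : M.carrier) : p m := by
  have hm : m ∈ Submodule.span k {m : M.carrier | ∃ (a : A), ∃ x ∈ M.deg t, m = M.act a x} := by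
    rw [hM]; trivial
  suffices ∀ c : k, p (c • m) by simpa using this 1
  induction hm using Submodule.span_induction with
  | mem x hx =>
    obtain ⟨a, x, hx, rfl⟩ := hx
    exact fun c => by rw [← map_smul]; exact act a _ (Submodule.smul_mem _ _ hx)
  | zero => exact fun c => by simpa using act 0 0 (zero_mem _)
  | add x y _ _ hx hy => exact fun c => by rw [smul_add]; exact add _ _ (hx c) (hy c)
  | smul d x _ hx => exact fun c => by rw [smul_smul]; exact hx _

/-- On a given element of a unital module, all sufficiently large sums of the idempotents act as the
identity. -/
theorem GrMod.exists_sum_idem_act [IsScalarTower k A A] [SMulCommClass k A A] {e : V → A}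
    [h : IsLocFinGraded 𝒜 e] (M : GrMod 𝒜) (m : M.carrier) :
    ∃ F : Finset V, ∀ G, F ⊆ G → M.act (∑ i ∈ G, e i) m = m := by
  classical
  induction m using M.unital.induction with
  | act a x =>
    obtain ⟨F, hF, -⟩ := h.local_unit a
    exact ⟨F, fun G hG => by rw [← M.act_mul, sum_idem_mul_of_subset 𝒜 hG hF]⟩
  | add x y hx hy =>
    obtain ⟨F, hF⟩ := hx
    obtain ⟨F', hF'⟩ := hy
    exact ⟨F ∪ F', fun G hG => by
      rw [map_add, hF G (Finset.union_subset_left hG), hF' G (Finset.union_subset_right hG)]⟩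

/-! ### Products -/

/-- The direct sum of two graded modules. -/
@[reducible]
def GrMod.prod (M N : GrMod 𝒜) : GrMod 𝒜 where
  carrier := M.carrier × N.carrier
  act := LinearMap.mk₂ k (fun a x => (M.act a x.1, N.act a x.2))
    (fun a b x => by simp) (fun c a x => by simp) (fun a x y => by simp) (fun c a x => by simp)
  act_mul a b x := by simp [M.act_mul, N.act_mul]
  unital := by
    have h1 : ∀ y : M.carrier, (y, (0 : N.carrier)) ∈ Submodule.span k
        {m : M.carrier × N.carrier | ∃ (a : A) (x : M.carrier × N.carrier),
          m = (M.act a x.1, N.act a x.2)} := by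
      intro y
      induction y using M.unital.induction with
      | act a x => exact Submodule.subset_span ⟨a, (x, 0), by simp⟩
      | add x y hx hy => simpa using add_mem hx hy
    have h2 : ∀ y : N.carrier, ((0 : M.carrier), y) ∈ Submodule.span k
        {m : M.carrier × N.carrier | ∃ (a : A) (x : M.carrier × N.carrier),
          m = (M.act a x.1, N.act a x.2)} := by
      intro y
      induction y using N.unital.induction with
      | act a x => exact Submodule.subset_span ⟨a, (0, x), by simp⟩
      | add x y hx hy => simpa using add_mem hx hy
    refine eq_top_iff.2 fun x _ => ?_
    simpa using add_mem (h1 x.1) (h2 x.2)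
  deg t := (M.deg t).prod (N.deg t)
  isInternal := isInternal_prod M.isInternal N.isInternal
  act_mem s t a x ha hx := ⟨M.act_mem s t a _ ha hx.1, N.act_mem s t a _ ha hx.2⟩

theorem GrMod.IsGeneratedIn.prod {M N : GrMod 𝒜} {t : ℤ} (hM : M.IsGeneratedIn t)
    (hN : N.IsGeneratedIn t) : (M.prod N).IsGeneratedIn t := by
  have h1 : ∀ y : M.carrier, (y, (0 : N.carrier)) ∈ Submodule.span k
      {m : (M.prod N).carrier | ∃ (a : A), ∃ x ∈ (M.prod N).deg t, m = (M.prod N).act a x} := by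
    intro y
    induction y using hM.induction with
    | act a x hx => exact Submodule.subset_span ⟨a, (x, 0), ⟨hx, zero_mem _⟩, by simp⟩
    | add x y hx hy => simpa using add_mem hx hy
  have h2 : ∀ y : N.carrier, ((0 : M.carrier), y) ∈ Submodule.span k
      {m : (M.prod N).carrier | ∃ (a : A), ∃ x ∈ (M.prod N).deg t, m = (M.prod N).act a x} := by
    intro y
    induction y using hN.induction with
    | act a x hx => exact Submodule.subset_span ⟨a, (0, x), ⟨zero_mem _, hx⟩, by simp⟩
    | add x y hx hy => simpa using add_mem hx hy
  refine eq_top_iff.2 fun x _ => ?_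
  simpa using add_mem (h1 x.1) (h2 x.2)

theorem GrMod.IsProjective.prod {P Q : GrMod 𝒜} (hP : P.IsProjective) (hQ : Q.IsProjective) :
    (P.prod Q).IsProjective := by
  intro M N f g hf
  obtain ⟨h1, hh1⟩ := hP M N f
    { toLin := g.toLin ∘ₗ LinearMap.inl k P.carrier Q.carrier
      map_act := fun a m => by
        have := g.map_act a (m, 0)
        simpa using this
      map_deg := fun t m hm => g.map_deg t (m, 0) ⟨hm, zero_mem _⟩ } hf
  obtain ⟨h2, hh2⟩ := hQ M N f
    { toLin := g.toLin ∘ₗ LinearMap.inr k P.carrier Q.carrier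
      map_act := fun a m => by
        have := g.map_act a (0, m)
        simpa using this
      map_deg := fun t m hm => g.map_deg t (0, m) ⟨zero_mem _, hm⟩ } hf
  refine ⟨{ toLin := h1.toLin.coprod h2.toLin
            map_act := fun a m => by simp [h1.map_act, h2.map_act]
            map_deg := fun t m hm => add_mem (h1.map_deg t _ hm.1) (h2.map_deg t _ hm.2) },
    fun x => ?_⟩
  rw [LinearMap.coprod_apply, map_add, hh1, hh2, LinearMap.comp_apply, LinearMap.comp_apply,
    ← map_add]
  simp

/-! ### Twists by automorphisms -/

variable (𝒜) in
/-- An automorphism of the graded algebra. -/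
structure GrAut where
  toLin : A ≃ₗ[k] A
  map_mul : ∀ a b, toLin (a * b) = toLin a * toLin b
  mem_iff : ∀ (t : ℕ) (a : A), toLin a ∈ 𝒜 t ↔ a ∈ 𝒜 t

/-- The inverse automorphism. -/
def GrAut.symm (ν : GrAut 𝒜) : GrAut 𝒜 where
  toLin := ν.toLin.symm
  map_mul a b := by
    rw [LinearEquiv.symm_apply_eq, ν.map_mul, LinearEquiv.apply_symm_apply,
      LinearEquiv.apply_symm_apply]
  mem_iff t a := by rw [← ν.mem_iff, LinearEquiv.apply_symm_apply]

/-- The module `M` on which `a` acts like `ν(a)`, with all the degrees raised by `c`. -/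
@[reducible]
def GrMod.twist (ν : GrAut 𝒜) (c : ℤ) (M : GrMod 𝒜) : GrMod 𝒜 where
  carrier := M.carrier
  act := M.act ∘ₗ ν.toLin.toLinearMap
  act_mul a b x := by simp [ν.map_mul, M.act_mul]
  unital := by
    refine eq_top_iff.2 fun x _ => ?_
    induction x using M.unital.induction with
    | act a x => exact Submodule.subset_span ⟨ν.toLin.symm a, x, by simp⟩
    | add x y hx hy => exact add_mem (hx trivial) (hy trivial)
  deg t := M.deg (t - c)
  isInternal := isInternal_sub M.isInternal c
  act_mem s t a x ha hx := by
    have := M.act_mem s _ _ x ((ν.mem_iff s a).2 ha) hx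
    rwa [← add_sub_assoc] at this

theorem GrMod.IsGeneratedIn.twist {M : GrMod 𝒜} {t : ℤ} (hM : M.IsGeneratedIn t) (ν : GrAut 𝒜)
    (c : ℤ) : (M.twist ν c).IsGeneratedIn (t + c) := by
  refine eq_top_iff.2 fun x _ => ?_
  induction x using hM.induction with
  | act a x hx =>
    refine Submodule.subset_span ⟨ν.toLin.symm a, x, ?_, by simp⟩
    change x ∈ M.deg (t + c - c)
    rwa [add_sub_cancel_right]
  | add x y hx hy => exact add_mem (hx trivial) (hy trivial)

theorem GrMod.IsProjective.twist {P : GrMod 𝒜} (hP : P.IsProjective) (ν : GrAut 𝒜) (c : ℤ) :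
    (P.twist ν c).IsProjective := by
  intro M N f g hf
  -- A map from the twist of `P` is the same as a map from `P` to the inverse twist.
  obtain ⟨h, hh⟩ := hP (M.twist ν.symm (-c)) (N.twist ν.symm (-c))
    { toLin := f.toLin
      map_act := fun a m => f.map_act _ m
      map_deg := fun t m hm => f.map_deg _ m hm }
    { toLin := g.toLin
      map_act := fun a m => by
        have h1 : g.toLin (P.act (ν.toLin (ν.toLin.symm a)) m) =
            N.act (ν.toLin.symm a) (g.toLin m) := g.map_act (ν.toLin.symm a) m
        rw [LinearEquiv.apply_symm_apply] at h1
        exact h1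
      map_deg := fun t m hm => g.map_deg _ m (by
        change m ∈ P.deg (t - -c - c)
        rwa [sub_neg_eq_add, add_sub_cancel_right]) } hf
  exact ⟨{ toLin := h.toLin
           map_act := fun a m => by
             have h1 : h.toLin (P.act (ν.toLin a) m) =
                 M.act (ν.toLin.symm (ν.toLin a)) (h.toLin m) := h.map_act (ν.toLin a) m
             rw [LinearEquiv.symm_apply_apply] at h1
             exact h1
           map_deg := fun t m hm => by
             have h1 : h.toLin m ∈ M.deg (t - c - -c) := h.map_deg (t - c) m hm
             rwa [sub_neg_eq_add, sub_add_cancel] at h1 }, hh⟩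

end GradedModules

/-! ### Induction from an algebra to its trivial extension -/

section Induction

open TrivExt

variable {k A V : Type u} [Field k] [NonUnitalRing A] [Module k A]
  [IsScalarTower k A A] [SMulCommClass k A A]
  {𝒜 : ℕ → Submodule k A} {e : V → A} [h : IsLocFinGraded 𝒜 e] {n : ℕ}

/-- The Nakayama automorphism. -/
def NakayamaIso.aut (N : NakayamaIso 𝒜 e n) : GrAut 𝒜 := ⟨N.ν, N.ν_mul, N.ν_mem⟩

/-- A graded `Λ`-module as a module over the trivial extension on which `D_* Λ` acts as `0`. -/
@[reducible]
def GrMod.inflate (e : V → A) [IsLocFinGraded 𝒜 e] (n : ℕ) (M : GrMod 𝒜) :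
    GrMod (grading 𝒜 e n) where
  carrier := M.carrier
  act := M.act ∘ₗ fstₗ 𝒜 e
  act_mul x y m := M.act_mul x.1 y.1 m
  unital := by
    refine eq_top_iff.2 fun x _ => ?_
    induction x using M.unital.induction with
    | act a x => exact Submodule.subset_span ⟨inl 𝒜 e a, x, rfl⟩
    | add x y hx hy => exact add_mem (hx trivial) (hy trivial)
  deg := M.deg
  isInternal := M.isInternal
  act_mem s t x m hx hm := M.act_mem s t x.1 m hx.1 hm

/-- A graded module over the trivial extension as a `Λ`-module. -/
@[reducible]
def GrMod.restrict (N : NakayamaIso 𝒜 e n) (M : GrMod (grading 𝒜 e n)) : GrMod 𝒜 where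
  carrier := M.carrier
  act := M.act ∘ₗ inl 𝒜 e
  act_mul a b m := by
    change M.act (inl 𝒜 e (a * b)) m = M.act (inl 𝒜 e a) (M.act (inl 𝒜 e b) m)
    rw [← inl_mul_inl, M.act_mul]
  unital := by
    have := N.isLocFinGraded_trivExt
    refine eq_top_iff.2 fun x _ => Submodule.subset_span ?_
    obtain ⟨F, hF⟩ := M.exists_sum_idem_act (e := idem 𝒜 e) x
    refine ⟨∑ i ∈ F, e i, x, ?_⟩
    have hsum : ∑ i ∈ F, idem 𝒜 e i = inl 𝒜 e (∑ i ∈ F, e i) := (map_sum (inl 𝒜 e) e _).symm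
    have h1 := hF F subset_rfl
    rw [hsum] at h1
    exact h1.symm
  deg := M.deg
  isInternal := M.isInternal
  act_mem s t a m ha hm := M.act_mem s t _ m (inl_mem_grading ha) hm

/-- The induced module `(Λ ⋉ D_* Λ) ⊗_Λ M`. As `D_* Λ = φ Λ` for a Frobenius form `φ` with
`a φ = φ ν(a)`, and `φ` has degree `1` in the trivial extension, it is `M ⊕ φ M`, a copy
of `M × M`. -/
@[reducible]
def NakayamaIso.induce (N : NakayamaIso 𝒜 e n) (M : GrMod 𝒜) : GrMod (grading 𝒜 e n) where
  carrier := M.carrier × M.carrier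
  act := LinearMap.mk₂ k
    (fun x m => (M.act x.1 m.1, M.act (N.r x.2) m.1 + M.act (N.ν x.1) m.2))
    (fun x y m => Prod.ext (by rw [add_fst, map_add]; rfl) (by
      have : (x + y).2 = x.2 + y.2 := rfl
      simp only [this, add_fst, map_add, LinearMap.add_apply, Prod.snd_add]
      abel))
    (fun c x m => Prod.ext (by rw [smul_fst, map_smul]; rfl) (by
      have : (c • x).2 = c • x.2 := rfl
      simp only [this, smul_fst, map_smul, LinearMap.smul_apply, Prod.smul_snd, smul_add]))
    (fun x m m' => Prod.ext (by simp) (by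
      simp only [Prod.fst_add, Prod.snd_add, map_add]
      abel))
    (fun c x m => Prod.ext (by simp) (by simp))
  act_mul x y m := Prod.ext (M.act_mul x.1 y.1 m.1) (by
    have : (x * y).2 = leftAct x.1 y.2 + rightAct x.2 y.1 := rfl
    simp only [LinearMap.mk₂_apply, this, mul_fst, map_add, N.r_left, N.r_right, N.ν_mul,
      LinearMap.add_apply, M.act_mul]
    abel)
  unital := by
    refine eq_top_iff.2 fun x _ => ?_
    have h1 : ∀ y : M.carrier, (y, (0 : M.carrier)) ∈ Submodule.span k
        {m : M.carrier × M.carrier | ∃ (x : TrivExt 𝒜 e) (m' : M.carrier × M.carrier),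
          m = (M.act x.1 m'.1, M.act (N.r x.2) m'.1 + M.act (N.ν x.1) m'.2)} := by
      intro y
      induction y using M.unital.induction with
      | act a x => exact Submodule.subset_span ⟨inl 𝒜 e a, (x, 0), by simp [inl_fst, inl_snd]⟩
      | add x y hx hy => simpa using add_mem hx hy
    have h2 : ∀ y : M.carrier, ((0 : M.carrier), y) ∈ Submodule.span k
        {m : M.carrier × M.carrier | ∃ (x : TrivExt 𝒜 e) (m' : M.carrier × M.carrier),
          m = (M.act x.1 m'.1, M.act (N.r x.2) m'.1 + M.act (N.ν x.1) m'.2)} := by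
      intro y
      induction y using M.unital.induction with
      | act a x =>
        exact Submodule.subset_span ⟨inl 𝒜 e (N.ν.symm a), (0, x), by simp [inl_fst, inl_snd]⟩
      | add x y hx hy => simpa using add_mem hx hy
    simpa using add_mem (h1 x.1) (h2 x.2)
  deg t := (M.deg t).prod (M.deg (t - 1))
  isInternal := isInternal_prod M.isInternal (isInternal_sub M.isInternal 1)
  act_mem s t x m hx hm := by
    refine ⟨M.act_mem s t _ _ hx.1 hm.1, add_mem ?_ ?_⟩
    · cases s with
      | zero =>
        rw [snd_eq_zero_of_mem_zero N.eq_bot hx, map_zero, map_zero]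
        exact zero_mem _
      | succ s =>
        have := M.act_mem s t _ _ (N.r_mem_of_mem_grading hx) hm.1
        convert this using 2
        push_cast
        ring
    · have := M.act_mem s (t - 1) _ _ ((N.ν_mem s _).2 hx.1) hm.2
      rwa [← add_sub_assoc] at this

variable (N : NakayamaIso 𝒜 e n)

theorem NakayamaIso.isGeneratedIn_induce {M : GrMod 𝒜} {t : ℤ} (hM : M.IsGeneratedIn t) :
    (N.induce M).IsGeneratedIn t := by
  have h1 : ∀ y : M.carrier, (y, (0 : M.carrier)) ∈ Submodule.span k
      {m : (N.induce M).carrier | ∃ x, ∃ m' ∈ (N.induce M).deg t, m = (N.induce M).act x m'} := by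
    intro y
    induction y using hM.induction with
    | act a x hx =>
      exact Submodule.subset_span ⟨inl 𝒜 e a, (x, 0), ⟨hx, zero_mem _⟩, by simp [inl_fst, inl_snd]⟩
    | add x y hx hy => simpa using add_mem hx hy
  have h2 : ∀ y : M.carrier, ((0 : M.carrier), y) ∈ Submodule.span k
      {m : (N.induce M).carrier | ∃ x, ∃ m' ∈ (N.induce M).deg t, m = (N.induce M).act x m'} := by
    intro y
    induction y using hM.induction with
    | act a x hx =>
      exact Submodule.subset_span ⟨inr 𝒜 e (N.r.symm a), (x, 0), ⟨hx, zero_mem _⟩,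
        by simp [inr_fst, inr_snd]⟩
    | add x y hx hy => simpa using add_mem hx hy
  refine eq_top_iff.2 fun x _ => ?_
  simpa using add_mem (h1 x.1) (h2 x.2)

/-- The multiplication by the Frobenius form `φ` on a module over the trivial extension: although
`φ` need not belong to `D_* Λ`, the forms `φ a = r⁻¹(a)` do, and the multiplication sends
`m` to `(φ e_G) m`, where `e_G` is any sufficiently large sum of the idempotents. -/
theorem NakayamaIso.exists_mul_generator (M : GrMod (grading 𝒜 e n)) :
    ∃ θ : M.carrier →ₗ[k] M.carrier, ∀ m, ∃ F : Finset V, ∀ G, F ⊆ G →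
      θ m = M.act (inr 𝒜 e (N.r.symm (∑ i ∈ G, e i))) m := by
  classical
  have := N.isLocFinGraded_trivExt
  have hsum : ∀ G : Finset V, ∑ i ∈ G, idem 𝒜 e i = inl 𝒜 e (∑ i ∈ G, e i) := fun G =>
    (map_sum (inl 𝒜 e) e _).symm
  choose F hF using M.exists_sum_idem_act (e := idem 𝒜 e)
  have key : ∀ m G, F m ⊆ G → M.act (inr 𝒜 e (N.r.symm (∑ i ∈ F m, e i))) m =
      M.act (inr 𝒜 e (N.r.symm (∑ i ∈ G, e i))) m := by
    intro m G hG
    conv_rhs => rw [← hF m (F m) subset_rfl]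
    rw [hsum, ← M.act_mul, inr_mul_inl, ← N.symm_mul, sum_idem_mul_sum_idem 𝒜 hG]
  refine ⟨{ toFun := fun m => M.act (inr 𝒜 e (N.r.symm (∑ i ∈ F m, e i))) m
            map_add' := fun x y => ?_
            map_smul' := fun c x => ?_ }, fun m => ⟨F m, key m⟩⟩
  · have hxy := key (x + y) (F (x + y) ∪ (F x ∪ F y)) Finset.subset_union_left
    have hx := key x (F (x + y) ∪ (F x ∪ F y))
      (Finset.subset_union_left.trans Finset.subset_union_right)
    have hy := key y (F (x + y) ∪ (F x ∪ F y))
      (Finset.subset_union_right.trans Finset.subset_union_right)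
    rw [hxy, hx, hy, map_add]
  · have hcx := key (c • x) (F (c • x) ∪ F x) Finset.subset_union_left
    have hx := key x (F (c • x) ∪ F x) Finset.subset_union_right
    rw [hcx, hx, map_smul, RingHom.id_apply]

/-- Induction is left adjoint to restriction, so it preserves projectivity: a homomorphism `g`
from `P` to the restriction of `M` extends to `(p, p') ↦ g p + φ (g p')`. -/
theorem NakayamaIso.isProjective_induce {P : GrMod 𝒜} (hP : P.IsProjective) :
    (N.induce P).IsProjective := by
  classical
  intro M M' f g hf
  obtain ⟨h0, hh0⟩ := hP (M.restrict N) (M'.restrict N)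
    { toLin := f.toLin
      map_act := fun a m => f.map_act _ m
      map_deg := fun t m hm => f.map_deg _ m hm }
    { toLin := g.toLin ∘ₗ LinearMap.inl k P.carrier P.carrier
      map_act := fun a m => by
        have := g.map_act (inl 𝒜 e a) (m, 0)
        simpa [inl_fst, inl_snd] using this
      map_deg := fun t m hm => g.map_deg t (m, 0) ⟨hm, zero_mem _⟩ } hf
  have hact : ∀ a p, h0.toLin (P.act a p) = M.act (inl 𝒜 e a) (h0.toLin p) :=
    fun a p => h0.map_act a p
  obtain ⟨θ, hθ⟩ := N.exists_mul_generator M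
  -- This is the identity `φ (a m) = (φ a) m`.
  have hθ1 : ∀ a m, θ (M.act (inl 𝒜 e a) m) = M.act (inr 𝒜 e (N.r.symm a)) m := by
    intro a m
    obtain ⟨F, hF⟩ := hθ (M.act (inl 𝒜 e a) m)
    obtain ⟨F', hF', -⟩ := h.local_unit a
    rw [hF (F ∪ F') Finset.subset_union_left, ← M.act_mul, inr_mul_inl, ← N.symm_mul,
      sum_idem_mul_of_subset 𝒜 Finset.subset_union_right hF']
  -- This is the identity `a (φ m) = (φ ν(a)) m`.
  have hθ2 : ∀ a m, M.act (inl 𝒜 e a) (θ m) = M.act (inr 𝒜 e (N.r.symm (N.ν a))) m := by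
    intro a m
    obtain ⟨F, hF⟩ := hθ m
    obtain ⟨F', -, hF'⟩ := h.local_unit (N.ν a)
    rw [hF (F ∪ F') Finset.subset_union_left, ← M.act_mul, inl_mul_inr, ← N.symm_ν_mul,
      mul_sum_idem_of_subset 𝒜 Finset.subset_union_right hF']
  have hθ3 : ∀ x m, M.act (inr 𝒜 e x) (θ m) = 0 := by
    intro x m
    obtain ⟨F, hF⟩ := hθ m
    rw [hF F subset_rfl, ← M.act_mul, inr_mul_inr, map_zero, LinearMap.zero_apply]
  refine ⟨{ toLin := h0.toLin.coprod (θ ∘ₗ h0.toLin)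
            map_act := fun x p => ?_
            map_deg := fun t p hp => ?_ }, fun p => ?_⟩
  · change h0.toLin (P.act x.1 p.1) + θ (h0.toLin (P.act (N.r x.2) p.1 + P.act (N.ν x.1) p.2)) =
      M.act x (h0.toLin p.1 + θ (h0.toLin p.2))
    conv_rhs => rw [eq_inl_add_inr x]
    rw [map_add h0.toLin, hact, hact, hact, map_add θ, hθ1, hθ1, LinearEquiv.symm_apply_apply,
      map_add M.act, LinearMap.add_apply, map_add, map_add, hθ2, hθ3]
    abel
  · refine add_mem (h0.map_deg t _ hp.1) ?_
    obtain ⟨F, hF⟩ := hθ (h0.toLin p.2)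
    have h1 := M.act_mem 1 (t - 1) _ (h0.toLin p.2)
      (N.inr_symm_mem_grading (sum_idem_mem (𝒜 := 𝒜) (e := e) F)) (h0.map_deg _ _ hp.2)
    rw [Nat.cast_one, add_sub_cancel] at h1
    change θ (h0.toLin p.2) ∈ M.deg t
    rw [hF F subset_rfl]
    exact h1
  · obtain ⟨F, hF⟩ := hθ (h0.toLin p.2)
    obtain ⟨F', hF'⟩ := P.exists_sum_idem_act (e := e) p.2
    change f.toLin (h0.toLin p.1 + θ (h0.toLin p.2)) = g.toLin p
    have h1 : ∀ q, f.toLin (h0.toLin q) = g.toLin (q, 0) := hh0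
    rw [map_add, h1, hF (F ∪ F') Finset.subset_union_left, f.map_act, h1, ← g.map_act, ← map_add]
    congr 1
    change (p.1, 0) + (P.act 0 p.2, P.act (N.r (N.r.symm (∑ i ∈ F ∪ F', e i))) p.2 +
      P.act (N.ν 0) 0) = p
    rw [LinearEquiv.apply_symm_apply, hF' (F ∪ F') Finset.subset_union_right]
    simp

end Induction

/-! ### Linear resolutions over the trivial extension -/

section Resolution

open TrivExt

variable {k A V : Type u} [Field k] [NonUnitalRing A] [Module k A]
  [IsScalarTower k A A] [SMulCommClass k A A]
  {𝒜 : ℕ → Submodule k A} {e : V → A} [h : IsLocFinGraded 𝒜 e] {n : ℕ}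

/-- The map `(x, p) ↦ d p` on `X^ν(-1) ⊕ P`. -/
@[reducible]
def GrHom.lastMap (ν : GrAut 𝒜) {P X Y : GrMod 𝒜} (d : GrHom P Y) :
    GrHom ((X.twist ν 1).prod P) Y where
  toLin := d.toLin ∘ₗ LinearMap.snd k X.carrier P.carrier
  map_act a m := d.map_act a m.2
  map_deg t m hm := d.map_deg t m.2 hm.2

/-- The map `(x, p) ↦ (-δ x, d p)` on `X^ν(-1) ⊕ P`. -/
@[reducible]
def GrHom.stepMap (ν : GrAut 𝒜) {X Y P P' : GrMod 𝒜} (δ : GrHom X Y) (d : GrHom P P') :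
    GrHom ((X.twist ν 1).prod P) ((Y.twist ν 1).prod P') where
  toLin := (-δ.toLin).prodMap d.toLin
  map_act a m := Prod.ext (by
    change -δ.toLin (X.act (ν.toLin a) m.1) = Y.act (ν.toLin a) (-δ.toLin m.1)
    rw [δ.map_act, map_neg]) (d.map_act a m.2)
  map_deg t m hm := ⟨neg_mem (δ.map_deg _ _ hm.1), d.map_deg _ _ hm.2⟩

/-- The map `(x, y) ↦ (δ x, δ y + π x)` between induced modules, where `π` is the projection of
`X^ν(-1) ⊕ P` onto its first summand. -/
@[reducible]
def NakayamaIso.induceMap (N : NakayamaIso 𝒜 e n) {X P : GrMod 𝒜}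
    (δ : GrHom ((X.twist N.aut 1).prod P) X) :
    GrHom (N.induce ((X.twist N.aut 1).prod P)) (N.induce X) where
  toLin := (δ.toLin ∘ₗ LinearMap.fst k _ _).prod
    (δ.toLin ∘ₗ LinearMap.snd k _ _ + LinearMap.fst k X.carrier P.carrier ∘ₗ LinearMap.fst k _ _)
  map_act x m := Prod.ext (δ.map_act x.1 m.1) (by
    change δ.toLin (((X.twist N.aut 1).prod P).act (N.r x.2) m.1 +
        ((X.twist N.aut 1).prod P).act (N.ν x.1) m.2) + X.act (N.ν x.1) m.1.1 =
      X.act (N.r x.2) (δ.toLin m.1) + X.act (N.ν x.1) (δ.toLin m.2 + m.1.1)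
    rw [map_add, δ.map_act, δ.map_act, map_add, add_assoc])
  map_deg t m hm := by
    refine ⟨δ.map_deg _ _ hm.1, ?_⟩
    change δ.toLin m.2 + m.1.1 ∈ X.deg (t - 1)
    exact add_mem (δ.map_deg _ _ hm.2) hm.1.1

namespace AugSeq

/-- The modules `G^t = ⨁_{a ≤ t} P^a`, where `P^a` is twisted by `ν^{t-a}` and has its degrees
raised by `t - a`. -/
def twistedSum (ν : GrAut 𝒜) (C : AugSeq 𝒜) : ℕ → GrMod 𝒜
  | 0 => C.P 0
  | t + 1 => ((twistedSum ν C t).twist ν 1).prod (C.P (t + 1))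

/-- The map `G^{t+1} → G^t` which is `± d : P^{a+1} → P^a` on the summands and zero on `P^0`. -/
def twistedMap (ν : GrAut 𝒜) (C : AugSeq 𝒜) :
    (t : ℕ) → GrHom (C.twistedSum ν (t + 1)) (C.twistedSum ν t)
  | 0 => GrHom.lastMap ν (C.d 0)
  | t + 1 => GrHom.stepMap ν (twistedMap ν C t) (C.d (t + 1))

/-- The total complex of the double complex whose rows are the resolutions
`⋯ → Ind(M^{ν²})(-2) → Ind(M^ν)(-1) → Ind(M) → M` of the modules `M` in `C`. -/
def trivExt (N : NakayamaIso 𝒜 e n) (C : AugSeq 𝒜) : AugSeq (grading 𝒜 e n) where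
  S := C.S.inflate e n
  P t := N.induce (C.twistedSum N.aut t)
  d t := N.induceMap (C.twistedMap N.aut t)
  aug :=
    { toLin := C.aug.toLin ∘ₗ LinearMap.fst k (C.P 0).carrier (C.P 0).carrier
      map_act := fun x m => C.aug.map_act x.1 m.1
      map_deg := fun t m hm => C.aug.map_deg t m.1 hm.1 }

variable (N : NakayamaIso 𝒜 e n) (C : AugSeq 𝒜)

theorem isProjective_twistedSum (ν : GrAut 𝒜) (hC : ∀ t, (C.P t).IsProjective) (t : ℕ) :
    (C.twistedSum ν t).IsProjective := by
  induction t with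
  | zero => exact hC 0
  | succ t ih => exact (ih.twist ν 1).prod (hC (t + 1))

theorem isGeneratedIn_twistedSum (ν : GrAut 𝒜) (hC : ∀ t, (C.P t).IsGeneratedIn (t : ℕ))
    (t : ℕ) : (C.twistedSum ν t).IsGeneratedIn (t : ℕ) := by
  induction t with
  | zero => exact hC 0
  | succ t ih =>
    have h1 := ih.twist ν 1
    have h2 := hC (t + 1)
    rw [Nat.cast_succ] at h2 ⊢
    exact h1.prod h2

theorem twistedMap_twistedMap (ν : GrAut 𝒜)
    (hC : ∀ t x, (C.d t).toLin ((C.d (t + 1)).toLin x) = 0) (t : ℕ)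
    (x : (C.twistedSum ν (t + 2)).carrier) :
    (C.twistedMap ν t).toLin ((C.twistedMap ν (t + 1)).toLin x) = 0 := by
  induction t with
  | zero => exact hC 0 x.2
  | succ t ih =>
    refine Prod.ext ?_ (hC (t + 1) x.2)
    change -(C.twistedMap ν t).toLin (-(C.twistedMap ν (t + 1)).toLin x.1) = 0
    rw [map_neg, neg_neg]
    exact ih x.1

theorem d_snd_eq_zero (ν : GrAut 𝒜) (t : ℕ) (x : (C.twistedSum ν (t + 1)).carrier)
    (hx : (C.twistedMap ν t).toLin x = 0) : (C.d t).toLin x.2 = 0 := by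
  cases t with
  | zero => exact hx
  | succ t => exact congrArg Prod.snd hx

/-- A cycle `(x, y)` with `x = (x', p)` satisfies `δ x = 0` and `δ y = -x'`, so that it is the
image of `((y, q), 0)` where `d q = p`: exactness is needed at the last summand only. -/
theorem cycles_trivExt (hC : ∀ t, C.cycles t = C.boundaries t) (t : ℕ) :
    (C.trivExt N).cycles t = (C.trivExt N).boundaries t := by
  have hdd : ∀ t x, (C.d t).toLin ((C.d (t + 1)).toLin x) = 0 := by
    intro t x
    have : (C.d (t + 1)).toLin x ∈ C.cycles (t + 1) := by
      rw [hC]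
      exact ⟨x, rfl⟩
    exact this
  cases t with
  | zero =>
    refine le_antisymm ?_ ?_
    · rintro ⟨x, y⟩ hxy
      have hx : x ∈ C.cycles 0 := hxy
      rw [hC] at hx
      obtain ⟨p, hp⟩ := hx
      refine ⟨((y, p), 0), Prod.ext hp ?_⟩
      change (C.twistedMap N.aut 0).toLin 0 + y = y
      rw [map_zero, zero_add]
    · rintro _ ⟨x, rfl⟩
      have : (C.d 0).toLin x.1.2 ∈ C.cycles 0 := by
        rw [hC]
        exact ⟨_, rfl⟩
      exact this
  | succ t =>
    refine le_antisymm ?_ ?_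
    · rintro ⟨x, y⟩ hxy
      have hx : (C.twistedMap N.aut t).toLin x = 0 := congrArg Prod.fst hxy
      have hy : (C.twistedMap N.aut t).toLin y + x.1 = 0 := congrArg Prod.snd hxy
      have hx2 : x.2 ∈ C.cycles (t + 1) := C.d_snd_eq_zero N.aut t x hx
      rw [hC] at hx2
      obtain ⟨q, hq⟩ := hx2
      refine ⟨((y, q), 0), Prod.ext (Prod.ext ?_ hq) ?_⟩
      · change -(C.twistedMap N.aut t).toLin y = x.1
        exact neg_eq_of_add_eq_zero_right hy
      · change (C.twistedMap N.aut (t + 1)).toLin 0 + y = y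
        rw [map_zero, zero_add]
    · rintro _ ⟨⟨x, y⟩, rfl⟩
      have hδδ := C.twistedMap_twistedMap N.aut hdd t
      refine Prod.ext (hδδ x) ?_
      change (C.twistedMap N.aut t).toLin ((C.twistedMap N.aut (t + 1)).toLin y + x.1) +
        -(C.twistedMap N.aut t).toLin x.1 = 0
      rw [map_add, hδδ, zero_add, add_neg_cancel]

end AugSeq

/-- The trivial extension of a Koszul algebra with a Nakayama automorphism is Koszul: the simple
modules have linear resolutions, so that the second parameter is `∞`. -/
theorem NakayamaIso.isPQKoszul_trivExt (N : NakayamaIso 𝒜 e n) (hK : IsKoszul 𝒜 e) :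
    IsPQKoszul (grading 𝒜 e n) (idem 𝒜 e) ((n + 1 + 1 : ℕ) : ℕ∞) ⊤ := by
  refine ⟨fun t ht => grading_eq_bot N.eq_bot t (by exact_mod_cast ht), fun i => ?_⟩
  obtain ⟨C, ⟨hS0, s, hs0, hs, hspan⟩, haug, hP, -, hC, -⟩ := hK.2 i
  refine ⟨C.trivExt N, ⟨hS0, s, hs0, hs, hspan⟩, fun x => ?_, fun t => ⟨?_, ?_⟩, fun t ht => ?_,
    fun t _ => ?_, fun t ht => ?_⟩
  · obtain ⟨y, hy⟩ := haug x
    exact ⟨(y, 0), hy⟩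
  · exact N.isProjective_induce (C.isProjective_twistedSum N.aut (fun t => (hP t).1) t)
  · exact N.isGeneratedIn_induce (C.isGeneratedIn_twistedSum N.aut (fun t => (hP t).2) t)
  · exact absurd ht not_top_lt
  · exact C.cycles_trivExt N (fun t => hC t (ENat.natCast_lt_top t)) t
  · exact absurd ht (ENat.natCast_ne_top t)

end Resolution

end NTrans

theorem mainTheorem7 {k A V : Type u} [Field k] [NonUnitalRing A] [Module k A]
    [IsScalarTower k A A] [SMulCommClass k A A]
    (𝒜 : ℕ → Submodule k A) (e : V → A) [NTrans.IsLocFinGraded 𝒜 e] (n : ℕ)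
    (hKoszul : NTrans.IsKoszul 𝒜 e)
    (hSelfInjective : NTrans.IsSelfInjective (k := k) e)
    (hTranslation : NTrans.IsNTranslationAlgebra 𝒜 e n) :
    NTrans.IsNTranslationAlgebra (NTrans.TrivExt.grading 𝒜 e n) (NTrans.TrivExt.idem 𝒜 e)
      (n + 1) := by
  obtain ⟨τ, w, hT⟩ := NTrans.exists_isTopNondegenerate hSelfInjective hTranslation
  obtain ⟨φ, hφ⟩ := hT.exists_isFrobeniusForm
  obtain ⟨N⟩ := hφ.nonempty_nakayamaIso
  have hloc := N.isLocFinGraded_trivExt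
  obtain ⟨Q⟩ := NTrans.exists_arrowSystem (NTrans.TrivExt.grading 𝒜 e n) (NTrans.TrivExt.idem 𝒜 e)
  exact ⟨hloc, ⟨Q, ∅, ∅, Equiv.refl _, Q.isNTranslationQuiver_refl
    (NTrans.TrivExt.exists_mul_ne_zero N.eq_bot)
    (NTrans.TrivExt.not_linearIndependent_top N.eq_bot)⟩, ⊤, N.isPQKoszul_trivExt hKoszul⟩
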